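/- Let $-\tfrac12<H<\tfrac12$, $T>0$, $h:=H+\tfrac12$, and $$K(t)=\frac{t^{H-1/2}}{\Gamma(H+1/2)},\qquad c_H=\frac1{\Gamma(H+1/2)\,\Gamma(1/2-H)} .$$ Let $\mathrm{rd}$ denote rounding to the nearest positive integer. For $N\in\mathbb N$ and $\alpha,\beta,a,b>0$, the geometric Gaussian rule of type $(H,N,\alpha,\beta,a,b)$ is defined as follows. Put $$m=\mathrm{rd}\big(\beta\sqrt{hN}\big),\qquad n=\mathrm{rd}\Big(\tfrac1\beta\sqrt{N/h}\Big),\qquad \xi_0=0,\qquad \xi_n=b\,e^{\alpha\sqrt{N}/\sqrt{h}},\qquad \xi_i=a\,(\xi_n/a)^{i/n}\quad(1\le i\le n).$$ Let $x_1,\dots,x_m$ and $\widetilde w_1,\dots,\widetilde w_m$ be the nodes and weights of the $m$-point Gaussian quadrature formula on $[0,\xi_1]$ for the weight function $c_Hx^{-H-1/2}$; for $1\le i\le n-1$ let $x_{im+1},\dots,x_{(i+1)m}$ and $\widetilde w_{im+1},\dots,\widetilde w_{(i+1)m}$ be those of the $m$-point Gaussian quadrature formula on $[\xi_i,\xi_{i+1}]$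 for the weight function $1$. Put $w_j=\widetilde w_j$ for $j\le m$, $w_j=c_H\widetilde w_jx_j^{-H-1/2}$ for $j>m$, and $K^N(t)=\sum_{j=1}^{mn}w_je^{-x_jt}$. For nonnegative sequences, write $f_N\lesssim g_N$ if for every $\varepsilon>0$ one has $f_N\le(1+\varepsilon)g_N$ for all sufficiently large $N$. Let $\alpha=\log(3+2\sqrt2)$, $\beta=1$ and $a=\frac{10\sqrt2-14}{e}\sqrt{hN}\,T^{-1}$. (i) If $b=\frac{10\sqrt2-14}{e}T^{-1}$, then $$\int_0^T|K(t)-K^N(t)|\,dt\;\lesssim\;\frac{c_H}{H+1/2}\,T^{H+1/2}\Big(\frac{e}{10\sqrt2-14}\Big)^{H+1/2}(\sqrt2+1)^{-2\sqrt{(H+1/2)N}} .$$ (ii) If instead $b=\frac{10\sqrt2-14}{e}\,((H+\tfrac12)N)^{1/4}\,T^{-1}$, then $$\int_0^T|K(t)-K^N(t)|\,dt\;\lesssim\;\max\Big\{\frac{200}{3},\frac{5}{H+1/2}\Big\}\,\theta_N\,c_H\,T^{H+1/2}\,N^{-H/4-1/8}(\sqrt2+1)^{-2\sqrt{(H+1/2)N}},$$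 where $\theta_N=\max\big\{1,(\sqrt2+1)^{2(\sqrt{hN}-m)+2h(\sqrt{N/h}-n)}\big\}$ accounts for the rounding of $m$ and $n$: $\theta_N=1$ whenever $\sqrt{hN}$ and $\sqrt{N/h}$ are integers, and $\theta_N\le(\sqrt2+1)^{H+3/2}$ for all sufficiently large $N$. In particular the constant is $\frac{200}{3}$ for $H\ge-\frac{17}{40}$ when no rounding takes place. -/

import Mathlib

open Filter Topology

noncomputable section

namespace RoughKernel

/-- The fractional kernel `K(t) = t^(H-1/2) / Γ(H+1/2)`. -/
def fracKernel (H t : ℝ) : ℝ := t ^ (H - 1 / 2) / Real.Gamma (H + 1 / 2)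

/-- The constant `c_H = 1 / (Γ(H+1/2) Γ(1/2-H))`. -/
def cH (H : ℝ) : ℝ := 1 / (Real.Gamma (H + 1 / 2) * Real.Gamma (1 / 2 - H))

/-- Rounding to the nearest positive integer. -/
def rd (x : ℝ) : ℕ := max 1 (round x).toNat

/-- `x` and `ω` are the nodes (in increasing order) and the weights of the Gaussian quadrature
formula of level `m` on `[u, v]` for the weight function `w`: the formula with `m` distinct nodes
in `[u, v]` that integrates all polynomials of degree at most `2 m - 1` exactly against `w`. -/
structure IsGaussQuadrature (w : ℝ → ℝ) (u v : ℝ) (m : ℕ) (x ω : Fin m → ℝ) : Prop where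
  strictMono : StrictMono x
  mem_Icc : ∀ j, x j ∈ Set.Icc u v
  exact_of_degree_lt : ∀ p : Polynomial ℝ, p.degree < ((2 * m : ℕ) : WithBot ℕ) →
    ∫ y in u..v, p.eval y * w y = ∑ j, ω j * p.eval (x j)

/-- The level `m` of the Gaussian quadrature formulas. -/
def level (H : ℝ) (N : ℕ) (β : ℝ) : ℕ := rd (β * √((1 / 2 + H) * N))

/-- The number `n` of intervals. -/
def numIntervals (H : ℝ) (N : ℕ) (β : ℝ) : ℕ := rd (1 / β * √(N / (1 / 2 + H)))

/-- The cutoff point `ξ_n`. -/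
def cutoff (H : ℝ) (N : ℕ) (α b : ℝ) : ℝ := b * Real.exp (α / √(1 / 2 + H) * √N)

/-- The partition points `ξ_0 = 0` and `ξ_i = a (ξ_n / a)^(i / n)` for `i ≥ 1`. -/
def xi (H : ℝ) (N : ℕ) (α β a b : ℝ) (i : ℕ) : ℝ :=
  if i = 0 then 0
  else a * (cutoff H N α b / a) ^ ((i : ℝ) / (numIntervals H N β : ℝ))

/-- The geometric Gaussian rule of type `(H, N, α, β, a, b)`. The node `node i j` is the `j`-th node
of the Gaussian quadrature formula on `[ξ_i, ξ_{i+1}]` and `gaussWeight i j` is its weight there. -/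
structure GeometricGaussianRule (H : ℝ) (N : ℕ) (α β a b : ℝ) where
  node : Fin (numIntervals H N β) → Fin (level H N β) → ℝ
  gaussWeight : Fin (numIntervals H N β) → Fin (level H N β) → ℝ
  isGauss_first : ∀ i : Fin (numIntervals H N β), (i : ℕ) = 0 →
    IsGaussQuadrature (fun x => cH H * x ^ (-H - 1 / 2))
      (xi H N α β a b 0) (xi H N α β a b 1) (level H N β) (node i) (gaussWeight i)
  isGauss_later : ∀ i : Fin (numIntervals H N β), (i : ℕ) ≠ 0 →
    IsGaussQuadrature (fun _ => 1)
      (xi H N α β a b i) (xi H N α β a b (i + 1)) (level H N β) (node i) (gaussWeight i)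

namespace GeometricGaussianRule

variable {H : ℝ} {N : ℕ} {α β a b : ℝ}

/-- The weights of the rule: the Gaussian weights on the first interval, and
`c_H * gaussWeight * x^(-H-1/2)` on the later intervals. -/
def weight (Q : GeometricGaussianRule H N α β a b)
    (i : Fin (numIntervals H N β)) (j : Fin (level H N β)) : ℝ :=
  if (i : ℕ) = 0 then Q.gaussWeight i j
  else cH H * Q.gaussWeight i j * Q.node i j ^ (-H - 1 / 2)

/-- The approximation `K^N(t) = ∑ w_j exp(-x_j t)` of the fractional kernel. -/
def kernel (Q : GeometricGaussianRule H N α β a b) (t : ℝ) : ℝ :=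
  ∑ i, ∑ j, Q.weight i j * Real.exp (-Q.node i j * t)

/-- The `L¹`-error `∫₀ᵀ |K(t) - K^N(t)| dt`. -/
def l1Error (Q : GeometricGaussianRule H N α β a b) (T : ℝ) : ℝ :=
  ∫ t in (0 : ℝ)..T, |fracKernel H t - Q.kernel t|

end GeometricGaussianRule

/-- The rounding factor
`max 1 ((√2+1)^(2 (√((H+1/2)N) - m) + 2 (H+1/2) (√(N/(H+1/2)) - n)))`, where `m`, `n` are the
roundings of the two square roots; it is `1` whenever the two square roots are integers. -/
def roundingFactor (H : ℝ) (N : ℕ) : ℝ :=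
  max 1 ((√2 + 1) ^ (2 * (√((H + 1 / 2) * N) - rd (√((H + 1 / 2) * N)))
    + 2 * (H + 1 / 2) * (√(N / (H + 1 / 2)) - rd (√(N / (H + 1 / 2))))))

end RoughKernel

end

/-! ### One-sided error of Gaussian quadrature for completely monotone integrands. -/

namespace RoughKernel

open Polynomial MeasureTheory Set
open scoped Interval

/-! Write `h = H + 1/2`, `P = √(h N)` and `α = log (3 + 2√2)`. The kernel is a Laplace transform,
`K(t) = c_H ∫₀^∞ y^(-h) e^(-yt) dy`, and cutting the integral at the partition points leaves three
errors: the tail beyond `ξ_n`, the intervals `[ξ_i, ξ_{i+1}]` with `i ≥ 1`, and `[0, ξ_1]`.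

On the later intervals the integrand is completely monotone in `y`, so Gaussian quadrature
underestimates it (`sum_laplace_le`). The error therefore has a sign, the absolute value disappears,
and time can be integrated out. This gives the error of `y^(-1-h)` minus that of `y^(-1-h) e^(-yT)`;
the latter is nonnegative and is dropped. The same one-sidedness allows a comparison: in Laplace
variables `s^h` is at most a multiple of `e^(δs)`, so the error of `y^(-1-h)` is at most that
multiple of the error of `1/(y - δ)` (`integral_rpow_sub_sum_le`). For this simple pole a squared
Chebyshev polynomial gives an explicit bound (`integral_inv_sub_sum_le`,
`integral_chebyshev_sq_div_le`). Moving the pole at distance of order `1/m` from the singularity at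
`0` costs only a bounded factor.

If consecutive points have ratio `e^v`, the Gaussian rate is `exp (-2m · gaussRate v)`. The tangent
inequality `exp_neg_gaussRate_le` bounds this by `exp (m v - 2 m α)`, with equality at `v = α`. The
chosen parameters force `v → α`, so both the later intervals and the tail decay like `exp (-α P) =
(√2+1)^(-2P)`. The errors of the later intervals form a geometric series. On `[0, ξ_1]` a Taylor
polynomial about the midpoint suffices: its error is smaller by an exponential factor
(`first_bound`).

Writing `b` as a constant times `P^(1-κ)`, the tail carries the factor `P^(-(1-κ)h)` and the later
intervals carry `P^(-κh)`. For `κ = 1` the tail alone survives, which is (i). For `κ = 1/2` the two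
balance, which is (ii), and `constant_le` estimates the sum of their constants. -/

/-- A polynomial with nonnegative coefficients keeps this property when it is divided by a product
of factors `X - r` with `r ≥ 0`. -/
theorem exists_eq_add_prod_mul_of_coeff_nonneg (f : ℝ[X]) (hf : ∀ k, 0 ≤ f.coeff k)
    (l : List ℝ) (hl : ∀ r ∈ l, 0 ≤ r) :
    ∃ R G : ℝ[X], f = R + (l.map fun r => X - C r).prod * G ∧
      R.degree < (l.length : WithBot ℕ) ∧ ∀ k, 0 ≤ G.coeff k := by
  induction l with
  | nil => exact ⟨0, f, by simp, by simp, hf⟩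
  | cons r l ih =>
    obtain ⟨R, G, hfR, hR, hG⟩ := ih fun s hs => hl s (List.mem_cons_of_mem _ hs)
    have hr : 0 ≤ r := hl r List.mem_cons_self
    refine ⟨R + (l.map fun r => X - C r).prod * C (G.eval r), G /ₘ (X - C r), ?_, ?_, ?_⟩
    · have h1 : (X - C r) * (G /ₘ (X - C r)) + C (G.eval r) = G := by
        have := modByMonic_add_div G (X - C r)
        rw [modByMonic_X_sub_C_eq_C_eval] at this
        rw [add_comm]; exact this
      rw [List.map_cons, List.prod_cons, hfR]
      linear_combination (-(l.map fun r => X - C r).prod) * h1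
    · have hd : ((l.map fun r => X - C r).prod).degree = (l.length : WithBot ℕ) := by
        clear ih hfR hR hl
        induction l with
        | nil => simp
        | cons s l ih => rw [List.map_cons, List.prod_cons, degree_mul, ih, degree_X_sub_C]
                         simp [add_comm]
      have hlt : (l.length : WithBot ℕ) < ((r :: l).length : WithBot ℕ) := by
        rw [List.length_cons]; exact_mod_cast Nat.lt_succ_self _
      refine (degree_add_le _ _).trans_lt (max_lt (hR.trans hlt) ?_)
      refine lt_of_le_of_lt ?_ hlt
      rw [degree_mul, hd]
      calc (l.length : WithBot ℕ) + (C (G.eval r)).degree ≤ l.length + 0 := by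
            gcongr; exact degree_C_le
        _ = _ := add_zero _
    · intro k
      rw [coeff_divByMonic_X_sub_C]
      exact Finset.sum_nonneg fun i _ => mul_nonneg (pow_nonneg hr _) (hG i)

namespace IsGaussQuadrature

variable {w : ℝ → ℝ} {u v : ℝ} {m : ℕ} {x ω : Fin m → ℝ}

/-- The square of the product of `X - x i` over the other nodes has degree `2(m-1)`, so it is
integrated exactly, and its quadrature sum reduces to the single term at `x j`. -/
theorem weight_nonneg (hQ : IsGaussQuadrature w u v m x ω) (huv : u ≤ v)
    (hw0 : ∀ y ∈ Icc u v, 0 ≤ w y) (j : Fin m) : 0 ≤ ω j := by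
  classical
  set p : ℝ[X] := ∏ i ∈ Finset.univ.erase j, (X - C (x i)) with hp
  have hdeg : p.degree = ((m - 1 : ℕ) : WithBot ℕ) := by
    rw [hp, degree_prod]
    simp [Finset.card_erase_of_mem]
  have hm : 0 < m := Fin.pos j
  have hdeg2 : (p ^ 2).degree < ((2 * m : ℕ) : WithBot ℕ) := by
    rw [degree_pow, hdeg, nsmul_eq_mul]
    exact_mod_cast (show 2 * (m - 1) < 2 * m by omega)
  have hex := hQ.exact_of_degree_lt _ hdeg2
  have hz : ∀ i, i ≠ j → (p ^ 2).eval (x i) = 0 := by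
    intro i hi
    rw [eval_pow, hp, eval_prod, Finset.prod_eq_zero (Finset.mem_erase.2 ⟨hi, Finset.mem_univ i⟩)]
    · simp
    · simp
  rw [Finset.sum_eq_single j (fun i _ hi => by rw [hz i hi, mul_zero])
    (fun h => absurd (Finset.mem_univ _) h)] at hex
  have hpos : 0 < (p ^ 2).eval (x j) := by
    rw [eval_pow]
    refine sq_pos_of_ne_zero ?_
    rw [hp, eval_prod, Finset.prod_ne_zero_iff]
    intro i hi
    simp only [eval_sub, eval_X, eval_C]
    exact sub_ne_zero.2 fun h => (Finset.mem_erase.1 hi).1 (hQ.strictMono.injective h.symm)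
  have hint : 0 ≤ ∫ y in u..v, (p ^ 2).eval y * w y :=
    intervalIntegral.integral_nonneg huv fun y hy => mul_nonneg (by
      rw [eval_pow]; positivity) (hw0 y hy)
  rw [hex] at hint
  exact nonneg_of_mul_nonneg_left hint hpos

theorem sum_weight (hQ : IsGaussQuadrature w u v m x ω) (hm : 0 < m) :
    ∑ j, ω j = ∫ y in u..v, w y := by
  have := hQ.exact_of_degree_lt 1 (by
    rw [degree_one]; exact_mod_cast (show 0 < 2 * m by omega))
  simpa using this.symm

/-- Gaussian quadrature underestimates the integral of a polynomial in `v - y` with nonnegative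
coefficients. -/
theorem sum_eval_comp_le (hQ : IsGaussQuadrature w u v m x ω) (huv : u ≤ v)
    (hw : IntervalIntegrable w volume u v) (hw0 : ∀ y ∈ Icc u v, 0 ≤ w y)
    (f : ℝ[X]) (hf : ∀ k, 0 ≤ f.coeff k) :
    ∑ j, ω j * f.eval (v - x j) ≤ ∫ y in u..v, f.eval (v - y) * w y := by
  -- Each reflected node `v - x j` is listed twice: the divisor becomes a perfect square of degree
  -- `2m`, the remainder `R` is integrated exactly, and the rest vanishes at the nodes and is
  -- nonnegative on the interval. No derivative formula for the error is needed.
  set l : List ℝ := (List.ofFn fun j => v - x j) ++ (List.ofFn fun j => v - x j) with hl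
  have hlen : l.length = 2 * m := by simp [hl]; ring
  obtain ⟨R, G, hfR, hR, hG⟩ := exists_eq_add_prod_mul_of_coeff_nonneg f hf l (by
    intro r hr
    have : ∃ j, v - x j = r := by simpa [hl, List.mem_ofFn] using hr
    obtain ⟨j, rfl⟩ := this
    exact sub_nonneg.2 (hQ.mem_Icc j).2)
  have hprod : (l.map fun r => X - C r).prod
      = (∏ j, (X - C (v - x j))) ^ 2 := by
    simp only [hl, List.map_append, List.map_ofFn, List.prod_append, List.prod_ofFn]
    rw [sq]; rfl
  rw [hlen] at hR
  have heval : ∀ y, f.eval y = R.eval y + (∏ j, (y - (v - x j))) ^ 2 * G.eval y := by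
    intro y
    conv_lhs => rw [hfR, hprod]
    simp [eval_prod]
  have hRint := hQ.exact_of_degree_lt (R.comp (C v - X)) (by
    rcases eq_or_ne R 0 with rfl | hR0
    · rw [zero_comp, degree_zero]; exact WithBot.bot_lt_coe _
    refine lt_of_le_of_lt degree_le_natDegree ?_
    have h1 : (R.comp (C v - X)).natDegree ≤ R.natDegree * 1 := by
      refine natDegree_comp_le.trans ?_
      gcongr
      exact (natDegree_sub_le _ _).trans (by simp)
    have h2 : R.natDegree < 2 * m := (natDegree_lt_iff_degree_lt hR0).2 hR
    exact_mod_cast (by omega : (R.comp (C v - X)).natDegree < 2 * m))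
  simp only [eval_comp, eval_sub, eval_C, eval_X] at hRint
  calc ∑ j, ω j * f.eval (v - x j) = ∑ j, ω j * R.eval (v - x j) := by
        refine Finset.sum_congr rfl fun j _ => ?_
        rw [heval, Finset.prod_eq_zero (Finset.mem_univ j) (by ring)]
        simp
    _ = ∫ y in u..v, R.eval (v - y) * w y := hRint.symm
    _ ≤ ∫ y in u..v, f.eval (v - y) * w y := by
        refine intervalIntegral.integral_mono_on huv ?_ ?_ fun y hy => ?_
        · exact hw.continuousOn_mul (R.continuous.comp (by fun_prop)).continuousOn
        · exact hw.continuousOn_mul (f.continuous.comp (by fun_prop)).continuousOn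
        · refine mul_le_mul_of_nonneg_right ?_ (hw0 y hy)
          rw [heval (v - y)]
          have : 0 ≤ G.eval (v - y) := by
            rw [eval_eq_sum_range]
            exact Finset.sum_nonneg fun i _ => mul_nonneg (hG i)
              (pow_nonneg (sub_nonneg.2 hy.2) _)
          nlinarith [mul_nonneg (sq_nonneg (∏ j, (v - y - (v - x j)))) this]

/-- Gaussian quadrature underestimates the integral of a decreasing exponential. -/
theorem sum_exp_le (hQ : IsGaussQuadrature w u v m x ω) (huv : u ≤ v)
    (hw : IntervalIntegrable w volume u v) (hw0 : ∀ y ∈ Icc u v, 0 ≤ w y) {s : ℝ} (hs : 0 ≤ s) :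
    ∑ j, ω j * Real.exp (-(s * x j)) ≤ ∫ y in u..v, Real.exp (-(s * y)) * w y := by
  -- Up to the factor `exp (-s v)`, the exponential is a power series in `v - y` with nonnegative
  -- coefficients; the polynomial case applies to its partial sums.
  have key : ∀ K : ℕ, ∑ j, ω j * ∑ k ∈ Finset.range K, (s * (v - x j)) ^ k / k.factorial
      ≤ ∫ y in u..v, Real.exp (s * (v - y)) * w y := by
    intro K
    set f : ℝ[X] := ∑ k ∈ Finset.range K, C (s ^ k / k.factorial) * X ^ k with hfdef
    have hfe : ∀ y, f.eval y = ∑ k ∈ Finset.range K, (s * y) ^ k / k.factorial := by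
      intro y
      simp only [hfdef, eval_finsetSum, eval_mul, eval_C, eval_pow, eval_X]
      exact Finset.sum_congr rfl fun k _ => by rw [mul_pow]; ring
    have hfc : ∀ k, 0 ≤ f.coeff k := by
      intro k
      simp only [hfdef, finsetSum_coeff, coeff_C_mul, coeff_X_pow]
      exact Finset.sum_nonneg fun i _ => mul_nonneg (by positivity) (by split_ifs <;> norm_num)
    have := hQ.sum_eval_comp_le huv hw hw0 f hfc
    simp only [hfe] at this
    refine this.trans ?_
    refine intervalIntegral.integral_mono_on huv ?_ ?_ fun y hy => ?_
    · exact hw.continuousOn_mul (by fun_prop)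
    · exact hw.continuousOn_mul (by fun_prop)
    · exact mul_le_mul_of_nonneg_right
        (Real.sum_le_exp_of_nonneg (mul_nonneg hs (sub_nonneg.2 hy.2)) K) (hw0 y hy)
  have hlim : Tendsto (fun K : ℕ => ∑ j, ω j * ∑ k ∈ Finset.range K,
      (s * (v - x j)) ^ k / k.factorial) atTop
      (𝓝 (∑ j, ω j * Real.exp (s * (v - x j)))) := by
    refine tendsto_finsetSum _ fun j _ => Tendsto.const_mul _ ?_
    have := NormedSpace.expSeries_div_hasSum_exp (s * (v - x j))
    rw [← Real.exp_eq_exp_ℝ] at this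
    exact this.tendsto_sum_nat
  have hle := le_of_tendsto' hlim key
  have h1 : ∀ y, Real.exp (-(s * y)) = Real.exp (-(s * v)) * Real.exp (s * (v - y)) := by
    intro y; rw [← Real.exp_add]; congr 1; ring
  calc ∑ j, ω j * Real.exp (-(s * x j))
      = Real.exp (-(s * v)) * ∑ j, ω j * Real.exp (s * (v - x j)) := by
        rw [Finset.mul_sum]
        exact Finset.sum_congr rfl fun j _ => by rw [h1]; ring
    _ ≤ Real.exp (-(s * v)) * ∫ y in u..v, Real.exp (s * (v - y)) * w y := by gcongr
    _ = ∫ y in u..v, Real.exp (-(s * y)) * w y := by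
        rw [← intervalIntegral.integral_const_mul]
        exact intervalIntegral.integral_congr fun y _ => by simp only [h1 y]; ring

/-- Gaussian quadrature underestimates the integral of a mixture of decreasing exponentials. -/
theorem sum_laplace_le (hQ : IsGaussQuadrature (fun _ => 1) u v m x ω) (huv : u ≤ v)
    {k : ℝ → ℝ} {t : ℝ} (ht : 0 ≤ t) (hk : ∀ s ∈ Ioi (0 : ℝ), 0 ≤ k s)
    (hint : ∀ y ∈ Icc u v, IntegrableOn (fun s => k s * Real.exp (-((s + t) * y))) (Ioi 0)) :
    ∑ j, ω j * ∫ s in Ioi (0 : ℝ), k s * Real.exp (-((s + t) * x j))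
      ≤ ∫ y in u..v, ∫ s in Ioi (0 : ℝ), k s * Real.exp (-((s + t) * y)) := by
  have hu := hint u (left_mem_Icc.2 huv)
  have : IsFiniteMeasure (volume.restrict (Ι u v)) := by rw [uIoc_of_le huv]; infer_instance
  have hprod : Integrable (Function.uncurry fun (y s : ℝ) => k s * Real.exp (-((s + t) * y)))
      ((volume.restrict (Ι u v)).prod (volume.restrict (Ioi 0))) := by
    -- The integrand at the left end point `u` dominates those at all other `y`, because the extra
    -- factor `exp (-(s+t)(y-u))` is at most `1`.
    have h0 : Integrable (fun z : ℝ × ℝ => (1 : ℝ) * (k z.2 * Real.exp (-((z.2 + t) * u))))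
        ((volume.restrict (Ι u v)).prod (volume.restrict (Ioi 0))) :=
      Integrable.mul_prod (f := fun _ : ℝ => (1 : ℝ)) (integrable_const _) hu
    have h1 : (Function.uncurry fun (y s : ℝ) => k s * Real.exp (-((s + t) * y)))
        = fun z : ℝ × ℝ => ((1 : ℝ) * (k z.2 * Real.exp (-((z.2 + t) * u))))
          * Real.exp (-((z.2 + t) * (z.1 - u))) := by
      ext ⟨y, s⟩
      simp only [Function.uncurry_apply_pair, one_mul, mul_assoc, ← Real.exp_add]
      congr 2; ring
    rw [h1]
    refine h0.mono (h0.aestronglyMeasurable.mul (Continuous.aestronglyMeasurable (by fun_prop))) ?_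
    rw [Measure.prod_restrict, uIoc_of_le huv]
    refine ae_restrict_of_forall_mem (measurableSet_Ioc.prod measurableSet_Ioi) ?_
    rintro ⟨y, s⟩ ⟨hy, hs⟩
    rw [norm_mul]
    refine mul_le_of_le_one_right (norm_nonneg _) ?_
    rw [Real.norm_eq_abs, Real.abs_exp, Real.exp_le_one_iff, neg_nonpos]
    exact mul_nonneg (add_nonneg (le_of_lt hs) ht) (sub_nonneg.2 (le_of_lt hy.1))
  have hswap := intervalIntegral_integral_swap (μ := volume.restrict (Ioi (0 : ℝ)))
    (f := fun y s => k s * Real.exp (-((s + t) * y))) hprod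
  rw [hswap]
  have hL : ∑ j, ω j * ∫ s in Ioi (0 : ℝ), k s * Real.exp (-((s + t) * x j))
      = ∫ s in Ioi (0 : ℝ), ∑ j, ω j * (k s * Real.exp (-((s + t) * x j))) := by
    rw [integral_finsetSum _ fun j _ => (hint (x j) (hQ.mem_Icc j)).const_mul (ω j)]
    exact Finset.sum_congr rfl fun j _ => (integral_const_mul _ _).symm
  rw [hL]
  refine setIntegral_mono_on ?_ ?_ measurableSet_Ioi fun s hs => ?_
  · exact integrable_finsetSum _ fun j _ => (hint (x j) (hQ.mem_Icc j)).const_mul (ω j)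
  · simp only [intervalIntegral.integral_of_le huv, ← uIoc_of_le huv]
    exact hprod.integral_prod_right
  · have := hQ.sum_exp_le huv (by simp) (fun _ _ => zero_le_one)
      (add_nonneg (le_of_lt (mem_Ioi.1 hs)) ht)
    simp only [mul_one] at this
    calc ∑ j, ω j * (k s * Real.exp (-((s + t) * x j)))
        = k s * ∑ j, ω j * Real.exp (-((s + t) * x j)) := by
          rw [Finset.mul_sum]; exact Finset.sum_congr rfl fun j _ => by ring
      _ ≤ k s * ∫ y in u..v, Real.exp (-((s + t) * y)) :=
          mul_le_mul_of_nonneg_left this (hk s hs)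
      _ = _ := (intervalIntegral.integral_const_mul _ _).symm

end IsGaussQuadrature

end RoughKernel

/-! ### Comparison of powers with a simple pole, and Chebyshev integrals. -/

namespace RoughKernel

open Polynomial MeasureTheory Set
open scoped Interval

theorem integrableOn_rpow_mul_exp_neg_mul {a r : ℝ} (ha : 0 < a) (hr : 0 < r) :
    IntegrableOn (fun s : ℝ => s ^ (a - 1) * Real.exp (-(r * s))) (Ioi 0) := by
  refine Integrable.of_integral_ne_zero ?_
  rw [Real.integral_rpow_mul_exp_neg_mul_Ioi ha hr]
  have := Real.Gamma_pos_of_pos ha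
  positivity

theorem integral_exp_neg_mul_Ioi {r : ℝ} (hr : 0 < r) :
    ∫ s in Ioi (0 : ℝ), Real.exp (-(r * s)) = 1 / r := by
  have := Real.integral_rpow_mul_exp_neg_mul_Ioi one_pos hr
  simpa using this

theorem integrableOn_exp_neg_mul {r : ℝ} (hr : 0 < r) :
    IntegrableOn (fun s : ℝ => Real.exp (-(r * s))) (Ioi 0) := by
  simpa using integrableOn_rpow_mul_exp_neg_mul one_pos hr

/-- The function `s^h e^(-δs)` is largest at `s = h/δ`; the inequality `1 + x ≤ e^x` at `x = δs/h -
1` expresses this without calculus. -/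
theorem rpow_le_const_mul_exp {h δ s : ℝ} (hh : 0 < h) (hδ : 0 < δ) (hs : 0 ≤ s) :
    s ^ h ≤ (h / (Real.exp 1 * δ)) ^ h * Real.exp (δ * s) := by
  have h1 : s ≤ h / (Real.exp 1 * δ) * Real.exp (δ * s / h) := by
    have h2 := Real.add_one_le_exp (δ * s / h - 1)
    rw [sub_add_cancel, Real.exp_sub] at h2
    rw [div_mul_eq_mul_div, le_div_iff₀ (by positivity)]
    have := mul_le_mul_of_nonneg_left h2 (by positivity : 0 ≤ h * Real.exp 1)
    have e1 : h * Real.exp 1 * (δ * s / h) = s * (Real.exp 1 * δ) := by field_simp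
    have e2 : h * Real.exp 1 * (Real.exp (δ * s / h) / Real.exp 1) = h * Real.exp (δ * s / h) := by
      field_simp
    rwa [e1, e2] at this
  calc s ^ h ≤ (h / (Real.exp 1 * δ) * Real.exp (δ * s / h)) ^ h := by gcongr
    _ = _ := by
      rw [Real.mul_rpow (by positivity) (by positivity), ← Real.exp_mul]
      congr 2; field_simp

namespace IsGaussQuadrature

variable {w : ℝ → ℝ} {u v : ℝ} {m : ℕ} {x ω : Fin m → ℝ}

/-- The integrand is the Laplace transform of the density `s^(p-1)/Γ(p)`, shifted by `t`. -/
theorem sum_rpow_mul_exp_le (hQ : IsGaussQuadrature (fun _ => 1) u v m x ω) (hu : 0 < u)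
    (huv : u ≤ v) {p t : ℝ} (hp : 0 < p) (ht : 0 ≤ t) :
    ∑ j, ω j * (x j ^ (-p) * Real.exp (-x j * t))
      ≤ ∫ y in u..v, y ^ (-p) * Real.exp (-y * t) := by
  have hΓ := Real.Gamma_pos_of_pos hp
  have hfun : ∀ y ∈ Icc u v, (fun s : ℝ => s ^ (p - 1) / Real.Gamma p * Real.exp (-((s + t) * y)))
      = fun s => (Real.exp (-y * t) / Real.Gamma p) * (s ^ (p - 1) * Real.exp (-(y * s))) := by
    intro y _
    ext s
    have : Real.exp (-((s + t) * y)) = Real.exp (-y * t) * Real.exp (-(y * s)) := by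
      rw [← Real.exp_add]; congr 1; ring
    rw [this]; ring
  have hval : ∀ y ∈ Icc u v,
      ∫ s in Ioi (0 : ℝ), s ^ (p - 1) / Real.Gamma p * Real.exp (-((s + t) * y))
        = y ^ (-p) * Real.exp (-y * t) := by
    intro y hy
    have hy0 : 0 < y := hu.trans_le hy.1
    rw [hfun y hy, integral_const_mul, Real.integral_rpow_mul_exp_neg_mul_Ioi hp hy0, one_div,
      Real.inv_rpow hy0.le, ← Real.rpow_neg hy0.le]
    field_simp
  have := hQ.sum_laplace_le huv (k := fun s => s ^ (p - 1) / Real.Gamma p) ht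
    (fun s hs => div_nonneg (Real.rpow_nonneg (le_of_lt hs) _) hΓ.le) (fun y hy => by
      rw [hfun y hy]
      exact (integrableOn_rpow_mul_exp_neg_mul hp (hu.trans_le hy.1)).const_mul _)
  calc _ = _ := Finset.sum_congr rfl fun j _ => by rw [hval _ (hQ.mem_Icc j)]
    _ ≤ _ := this
    _ = _ := intervalIntegral.integral_congr fun y hy => by
      rw [uIcc_of_le huv] at hy; exact hval y hy

/-- The functions `K/(y - δ)` and `y^(-1-h)` have Laplace densities `K e^(δs)` and `s^h/Γ(1+h)`. The
constant `K` makes the difference of the densities nonnegative, so quadrature underestimates the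
difference of the functions too, and the errors compare. -/
theorem integral_rpow_sub_sum_le (hQ : IsGaussQuadrature (fun _ => 1) u v m x ω) (hu : 0 < u)
    (huv : u ≤ v) {h δ : ℝ} (hh : 0 < h) (hδ : 0 < δ) (hδu : δ < u) :
    (∫ y in u..v, y ^ (-(1 + h))) - ∑ j, ω j * x j ^ (-(1 + h))
      ≤ (h / (Real.exp 1 * δ)) ^ h / Real.Gamma (1 + h)
        * ((∫ y in u..v, 1 / (y - δ)) - ∑ j, ω j * (1 / (x j - δ))) := by
  have hΓ : 0 < Real.Gamma (1 + h) := Real.Gamma_pos_of_pos (by linarith)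
  set K := (h / (Real.exp 1 * δ)) ^ h / Real.Gamma (1 + h) with hK
  have hfun : ∀ y ∈ Icc u v, (fun s : ℝ =>
      (K * Real.exp (δ * s) - s ^ h / Real.Gamma (1 + h)) * Real.exp (-((s + 0) * y)))
      = fun s => K * Real.exp (-((y - δ) * s))
        - (1 / Real.Gamma (1 + h)) * (s ^ (1 + h - 1) * Real.exp (-(y * s))) := by
    intro y _
    ext s
    have : Real.exp (-((y - δ) * s)) = Real.exp (δ * s) * Real.exp (-(y * s)) := by
      rw [← Real.exp_add]; congr 1; ring
    rw [this, add_zero, mul_comm s y, add_sub_cancel_left]; ring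
  have hi1 : ∀ y ∈ Icc u v, IntegrableOn (fun s : ℝ => K * Real.exp (-((y - δ) * s))) (Ioi 0) :=
    fun y hy => (integrableOn_exp_neg_mul (by linarith [hy.1])).const_mul _
  have hi2 : ∀ y ∈ Icc u v, IntegrableOn (fun s : ℝ => (1 / Real.Gamma (1 + h))
      * (s ^ (1 + h - 1) * Real.exp (-(y * s)))) (Ioi 0) :=
    fun y hy => (integrableOn_rpow_mul_exp_neg_mul (by linarith) (hu.trans_le hy.1)).const_mul _
  have hval : ∀ y ∈ Icc u v, ∫ s in Ioi (0 : ℝ),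
      (K * Real.exp (δ * s) - s ^ h / Real.Gamma (1 + h)) * Real.exp (-((s + 0) * y))
        = K * (1 / (y - δ)) - y ^ (-(1 + h)) := by
    intro y hy
    have hy0 : 0 < y := hu.trans_le hy.1
    rw [hfun y hy, integral_sub (hi1 y hy) (hi2 y hy), integral_const_mul, integral_const_mul,
      integral_exp_neg_mul_Ioi (by linarith [hy.1]),
      Real.integral_rpow_mul_exp_neg_mul_Ioi (by linarith) hy0, one_div y,
      Real.inv_rpow hy0.le, ← Real.rpow_neg hy0.le]
    field_simp
  have key := hQ.sum_laplace_le huv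
    (k := fun s => K * Real.exp (δ * s) - s ^ h / Real.Gamma (1 + h)) le_rfl
    (fun s hs => by
      have := div_le_div_of_nonneg_right (rpow_le_const_mul_exp hh hδ (le_of_lt hs)) hΓ.le
      rw [sub_nonneg, hK, div_mul_eq_mul_div]
      exact this) (fun y hy => by
      rw [hfun y hy]
      exact (hi1 y hy).sub (hi2 y hy))
  have e1 : ∑ j, ω j * ∫ s in Ioi (0 : ℝ),
      (K * Real.exp (δ * s) - s ^ h / Real.Gamma (1 + h)) * Real.exp (-((s + 0) * x j))
      = K * (∑ j, ω j * (1 / (x j - δ))) - ∑ j, ω j * x j ^ (-(1 + h)) := by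
    rw [Finset.mul_sum, ← Finset.sum_sub_distrib]
    exact Finset.sum_congr rfl fun j _ => by rw [hval _ (hQ.mem_Icc j)]; ring
  have e2 : (∫ y in u..v, ∫ s in Ioi (0 : ℝ),
      (K * Real.exp (δ * s) - s ^ h / Real.Gamma (1 + h)) * Real.exp (-((s + 0) * y)))
      = K * (∫ y in u..v, 1 / (y - δ)) - ∫ y in u..v, y ^ (-(1 + h)) := by
    rw [← intervalIntegral.integral_const_mul, ← intervalIntegral.integral_sub]
    · exact intervalIntegral.integral_congr fun y hy => by
        rw [uIcc_of_le huv] at hy; exact hval y hy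
    · refine ContinuousOn.intervalIntegrable fun y hy => ?_
      rw [uIcc_of_le huv] at hy
      have : y - δ ≠ 0 := by linarith [hy.1]
      exact ContinuousAt.continuousWithinAt (by fun_prop (disch := assumption))
    · refine ContinuousOn.intervalIntegrable fun y hy => ?_
      rw [uIcc_of_le huv] at hy
      exact (Real.continuousAt_rpow_const _ _ (Or.inl (hu.trans_le hy.1).ne')).continuousWithinAt
  rw [e1, e2] at key
  linarith

/-- A one-sided error bound for the Gaussian quadrature of `1 / (y - δ)`. -/
theorem integral_inv_sub_sum_le (hQ : IsGaussQuadrature (fun _ => 1) u v m x ω)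
    (huv : u ≤ v) {δ : ℝ} (hδu : δ < u) (hm : 0 < m) (S : ℝ[X]) (hS : S.natDegree ≤ 2 * m)
    (hS0 : ∀ y ∈ Icc u v, 0 ≤ S.eval y) (hSδ : 0 < S.eval δ) :
    (∫ y in u..v, 1 / (y - δ)) - ∑ j, ω j * (1 / (x j - δ))
      ≤ (∫ y in u..v, S.eval y / (y - δ)) / S.eval δ := by
  -- `D` vanishes at `δ`, so dividing by `X - δ` gives a polynomial of degree below `2m`. It differs
  -- from `1/(y - δ)` by `S(y)/((y - δ) S(δ))`, which is nonnegative; its quadrature sum can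
  -- therefore be discarded.
  set D : ℝ[X] := 1 - C (S.eval δ)⁻¹ * S with hD
  set R : ℝ[X] := D /ₘ (X - C δ) with hR
  have hroot : D.eval δ = 0 := by simp [hD, hSδ.ne']
  have hmul : (X - C δ) * R = D := mul_divByMonic_eq_iff_isRoot.2 hroot
  have hdegD : D.natDegree ≤ 2 * m := by
    refine (natDegree_sub_le _ _).trans (max_le (by simp) ?_)
    exact (natDegree_C_mul_le _ _).trans hS
  have hdegR : R.degree < ((2 * m : ℕ) : WithBot ℕ) := by
    refine lt_of_le_of_lt degree_le_natDegree ?_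
    rw [hR, natDegree_divByMonic _ (monic_X_sub_C δ), natDegree_X_sub_C]
    exact_mod_cast (by omega : D.natDegree - 1 < 2 * m)
  have hev : ∀ y, u ≤ y → 1 / (y - δ) = R.eval y + (S.eval y / (y - δ)) / S.eval δ := by
    intro y hy
    have h1 : (y - δ) * R.eval y = 1 - (S.eval δ)⁻¹ * S.eval y := by
      have := congrArg (eval y) hmul
      simpa [hD] using this
    have h2 : y - δ ≠ 0 := by linarith
    have h3 : S.eval δ ≠ 0 := hSδ.ne'
    field_simp at h1 ⊢
    linarith
  have hex := hQ.exact_of_degree_lt R hdegR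
  simp only [mul_one] at hex
  have hcont : ContinuousOn (fun y => S.eval y / (y - δ)) (uIcc u v) := by
    refine S.continuous.continuousOn.div (by fun_prop) fun y hy => ?_
    rw [uIcc_of_le huv] at hy
    linarith [hy.1]
  have hint : (∫ y in u..v, 1 / (y - δ))
      = (∫ y in u..v, R.eval y) + (∫ y in u..v, S.eval y / (y - δ)) / S.eval δ := by
    rw [← intervalIntegral.integral_div, ← intervalIntegral.integral_add]
    · exact intervalIntegral.integral_congr fun y hy => by
        rw [uIcc_of_le huv] at hy; exact hev y hy.1
    · exact R.continuous.intervalIntegrable _ _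
    · exact (hcont.div_const _).intervalIntegrable
  have hsum : ∑ j, ω j * R.eval (x j) ≤ ∑ j, ω j * (1 / (x j - δ)) := by
    refine Finset.sum_le_sum fun j _ => mul_le_mul_of_nonneg_left ?_
      (hQ.weight_nonneg huv (fun _ _ => zero_le_one) j)
    have hj := hQ.mem_Icc j
    rw [hev _ hj.1]
    have : 0 ≤ (S.eval (x j) / (x j - δ)) / S.eval δ :=
      div_nonneg (div_nonneg (hS0 _ hj) (by linarith [hj.1])) hSδ.le
    linarith
  rw [hint, hex]
  linarith

end IsGaussQuadrature

/-- This is `2 T_k = U_k - U_{k-2}` together with `T_j' = j U_{j-1}`; `k ≥ 2` keeps the denominator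
`k - 1` away from zero. -/
theorem hasDerivAt_chebyshev_antideriv (k : ℕ) (hk : 2 ≤ k) (y : ℝ) :
    HasDerivAt (fun y => ((Chebyshev.T ℝ (k + 1)).eval y / (k + 1)
      - (Chebyshev.T ℝ (k - 1)).eval y / (k - 1)) / 2) ((Chebyshev.T ℝ k).eval y) y := by
  have h1 := (Chebyshev.T ℝ (k + 1)).hasDerivAt y
  have h2 := (Chebyshev.T ℝ (k - 1)).hasDerivAt y
  refine (((h1.div_const ((k : ℝ) + 1)).sub (h2.div_const ((k : ℝ) - 1))).div_const 2).congr_deriv ?_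
  rw [Chebyshev.T_derivative_eq_U, Chebyshev.T_derivative_eq_U]
  have h3 := congrArg (eval y) (Chebyshev.two_mul_T_eq_U_sub_U ℝ (k - 2))
  simp only [eval_mul, eval_sub, eval_mul, sub_add_cancel, eval_ofNat] at h3
  have hk' : (2 : ℝ) ≤ k := by exact_mod_cast hk
  have e1 : ((k : ℤ) + 1 - 1) = k := by ring
  have e2 : ((k : ℤ) - 1 - 1) = k - 2 := by ring
  have h4 : (k : ℝ) - 1 ≠ 0 := by linarith
  rw [e1, e2, eval_mul, eval_mul]
  simp only [eval_intCast]
  push_cast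
  field_simp
  linarith

/-- Oscillation makes this integral `O(1/k)`. After integration by parts the antiderivative is at
most `1/(k-1)` in absolute value, and the two boundary terms plus the variation of the monotone
function `1/(y+z)` add up to `2/(z-1)`. -/
theorem integral_chebyshev_div_le (k : ℕ) (hk : 2 ≤ k) {z : ℝ} (hz : 1 < z) :
    ∫ y in (-1 : ℝ)..1, (Chebyshev.T ℝ k).eval y / (y + z) ≤ 2 / ((k - 1) * (z - 1)) := by
  set A : ℝ → ℝ := fun y => ((Chebyshev.T ℝ (k + 1)).eval y / (k + 1)
      - (Chebyshev.T ℝ (k - 1)).eval y / (k - 1)) / 2 with hA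
  have hk' : (2 : ℝ) ≤ k := by exact_mod_cast hk
  have hAb : ∀ y ∈ Icc (-1 : ℝ) 1, |A y| ≤ 1 / (k - 1) := by
    intro y hy
    have hy' : |y| ≤ 1 := abs_le.2 hy
    have h1 := Chebyshev.abs_eval_T_real_le_one (k + 1) hy'
    have h2 := Chebyshev.abs_eval_T_real_le_one (k - 1) hy'
    have h3 : |(Chebyshev.T ℝ (k + 1)).eval y / (k + 1)| ≤ 1 / (k - 1) := by
      rw [abs_div, abs_of_pos (by linarith : (0 : ℝ) < k + 1)]
      exact div_le_div₀ zero_le_one h1 (by linarith) (by linarith)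
    have h4 : |(Chebyshev.T ℝ (k - 1)).eval y / (k - 1)| ≤ 1 / (k - 1) := by
      rw [abs_div, abs_of_pos (by linarith : (0 : ℝ) < (k : ℝ) - 1)]
      exact div_le_div_of_nonneg_right h2 (by linarith)
    rw [hA]
    simp only [abs_div, abs_two]
    have := abs_sub ((Chebyshev.T ℝ (k + 1)).eval y / (k + 1))
      ((Chebyshev.T ℝ (k - 1)).eval y / (k - 1))
    linarith
  have hg : ∀ y ∈ uIcc (-1 : ℝ) 1, HasDerivAt (fun y => 1 / (y + z)) (-1 / (y + z) ^ 2) y := by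
    intro y hy
    rw [uIcc_of_le (by norm_num)] at hy
    have h0 : y + z ≠ 0 := by linarith [hy.1]
    simpa using ((hasDerivAt_id' y).add_const z).fun_inv h0
  have hgc : ContinuousOn (fun y : ℝ => -1 / (y + z) ^ 2) (uIcc (-1 : ℝ) 1) := by
    refine continuousOn_const.div (by fun_prop) fun y hy => ?_
    rw [uIcc_of_le (by norm_num)] at hy
    have h0 : y + z ≠ 0 := by linarith [hy.1]
    positivity
  have hA' : ∀ y ∈ uIcc (-1 : ℝ) 1, HasDerivAt A ((Chebyshev.T ℝ k).eval y) y :=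
    fun y _ => hasDerivAt_chebyshev_antideriv k hk y
  have hparts := intervalIntegral.integral_mul_deriv_eq_deriv_mul hg hA'
    hgc.intervalIntegrable ((Chebyshev.T ℝ k).continuous.intervalIntegrable _ _)
  have hAc : ContinuousOn A (uIcc (-1 : ℝ) 1) := fun y hy => (hA' y hy).continuousAt.continuousWithinAt
  set B : ℝ := 1 / (k - 1) with hB
  have hBpos : 0 < B := by rw [hB]; exact div_pos one_pos (by linarith)
  have hlow : -(∫ y in (-1 : ℝ)..1, -1 / (y + z) ^ 2 * A y)
      ≤ B * (1 / (z - 1) - 1 / (1 + z)) := by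
    have hgi : ∫ y in (-1 : ℝ)..1, -1 / (y + z) ^ 2 = 1 / (1 + z) - 1 / (-1 + z) :=
      intervalIntegral.integral_eq_sub_of_hasDerivAt hg hgc.intervalIntegrable
    have e : B * (1 / (z - 1) - 1 / (1 + z)) = ∫ y in (-1 : ℝ)..1, -(B * (-1 / (y + z) ^ 2)) := by
      rw [intervalIntegral.integral_neg, intervalIntegral.integral_const_mul, hgi]
      rw [show -1 + z = z - 1 by ring]; ring
    rw [e, ← intervalIntegral.integral_neg]
    refine intervalIntegral.integral_mono_on (by norm_num) ?_ ?_ fun y hy => ?_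
    · exact (hgc.mul hAc).neg.intervalIntegrable
    · exact (continuousOn_const.mul hgc).neg.intervalIntegrable
    · have h1 := hAb y hy
      have h2 : 0 ≤ 1 / (y + z) ^ 2 := by positivity
      have h3 := (abs_le.1 h1).2
      have e1 : -(-1 / (y + z) ^ 2 * A y) = 1 / (y + z) ^ 2 * A y := by ring
      have e2 : -(B * (-1 / (y + z) ^ 2)) = 1 / (y + z) ^ 2 * B := by ring
      rw [e1, e2]
      exact mul_le_mul_of_nonneg_left h3 h2
  have h1 := (abs_le.1 (hAb 1 (by norm_num))).2
  have h2 := (abs_le.1 (hAb (-1) (by norm_num))).1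
  have h3 : 1 / (1 + z) * A 1 ≤ 1 / (1 + z) * B := by gcongr
  have h4 : 1 / (z - 1) * (-A (-1)) ≤ 1 / (z - 1) * B := by
    have : 0 < z - 1 := by linarith
    gcongr; linarith
  calc ∫ y in (-1 : ℝ)..1, (Chebyshev.T ℝ k).eval y / (y + z)
      = ∫ y in (-1 : ℝ)..1, 1 / (y + z) * (Chebyshev.T ℝ k).eval y := by
        congr 1; ext y; ring
    _ ≤ 2 * B * (1 / (z - 1)) := by
        rw [hparts, show -1 + z = z - 1 by ring]; linarith
    _ = _ := by
        have : z - 1 ≠ 0 := by linarith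
        have : (k : ℝ) - 1 ≠ 0 := by linarith
        rw [hB]; field_simp

/-- Since `T_m² = (1 + T_{2m})/2`, the constant half gives the logarithm and the oscillating half is
negligible for large `m`. -/
theorem integral_chebyshev_sq_div_le (m : ℕ) (hm : 1 ≤ m) {z : ℝ} (hz : 1 < z) :
    ∫ y in (-1 : ℝ)..1, (Chebyshev.T ℝ m).eval y ^ 2 / (y + z)
      ≤ Real.log ((z + 1) / (z - 1)) / 2 + 1 / ((2 * m - 1) * (z - 1)) := by
  have hne : ∀ y ∈ uIcc (-1 : ℝ) 1, y + z ≠ 0 := by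
    intro y hy
    rw [uIcc_of_le (by norm_num)] at hy
    linarith [hy.1]
  have hsq : ∀ y : ℝ, (Chebyshev.T ℝ m).eval y ^ 2
      = (1 + (Chebyshev.T ℝ ((2 * m : ℕ) : ℤ)).eval y) / 2 := by
    intro y
    have := congrArg (eval y) (Chebyshev.T_mul_T ℝ m m)
    simp only [eval_mul, eval_add, sub_self, Chebyshev.T_zero, eval_one, eval_ofNat] at this
    push_cast
    rw [two_mul (m : ℤ)]
    linarith
  have hlog : ∫ y in (-1 : ℝ)..1, (y + z)⁻¹ = Real.log ((z + 1) / (z - 1)) := by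
    rw [intervalIntegral.integral_comp_add_right (fun y => y⁻¹),
      integral_inv_of_pos (by linarith) (by linarith)]
    congr 2 <;> ring
  have h2 := integral_chebyshev_div_le (2 * m) (by omega) hz
  calc ∫ y in (-1 : ℝ)..1, (Chebyshev.T ℝ m).eval y ^ 2 / (y + z)
      = ∫ y in (-1 : ℝ)..1, ((y + z)⁻¹ / 2
        + ((Chebyshev.T ℝ ((2 * m : ℕ) : ℤ)).eval y / (y + z)) / 2) := by
        congr 1; ext y; rw [hsq]; ring
    _ = Real.log ((z + 1) / (z - 1)) / 2
        + (∫ y in (-1 : ℝ)..1, (Chebyshev.T ℝ ((2 * m : ℕ) : ℤ)).eval y / (y + z)) / 2 := by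
        rw [intervalIntegral.integral_add, intervalIntegral.integral_div,
          intervalIntegral.integral_div, hlog]
        · refine ContinuousOn.intervalIntegrable ?_
          exact (ContinuousOn.inv₀ (by fun_prop) hne).div_const _
        · refine ContinuousOn.intervalIntegrable ?_
          exact ((Polynomial.continuous _).continuousOn.div (by fun_prop) hne).div_const _
    _ ≤ _ := by
        have e : 1 / ((2 * (m : ℝ) - 1) * (z - 1))
          = 2 / (((2 * m : ℕ) - 1 : ℝ) * (z - 1)) / 2 := by push_cast; ring
        rw [e]; linarith

end RoughKernel

/-! ### Time-integrated errors on a later interval, on the first interval and on the tail. -/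

namespace RoughKernel

open Polynomial MeasureTheory Set
open scoped Interval

theorem integrableOn_rpow_mul_exp_rectangle {u v T p : ℝ} (hu : 0 < u) (huv : u ≤ v) (hT : 0 ≤ T) :
    IntegrableOn (Function.uncurry fun t y : ℝ => y ^ p * Real.exp (-y * t))
      (Ι 0 T ×ˢ Ι u v) := by
  have hc : ContinuousOn (Function.uncurry fun t y : ℝ => y ^ p * Real.exp (-y * t))
      (Icc 0 T ×ˢ Icc u v) := by
    rintro ⟨t, y⟩ ⟨_, hy⟩
    refine ContinuousAt.continuousWithinAt (ContinuousAt.mul ?_ ?_)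
    · exact continuousAt_snd.rpow_const (Or.inl (hu.trans_le hy.1).ne')
    · fun_prop
  refine (hc.integrableOn_compact (isCompact_Icc.prod isCompact_Icc)).mono_set ?_
  rw [uIoc_of_le hT, uIoc_of_le huv]
  exact prod_mono Ioc_subset_Icc_self Ioc_subset_Icc_self

theorem intervalIntegrable_integral_rpow_mul_exp {u v T p : ℝ} (hu : 0 < u) (huv : u ≤ v)
    (hT : 0 ≤ T) :
    IntervalIntegrable (fun t => ∫ y in u..v, y ^ p * Real.exp (-y * t)) volume 0 T := by
  have h := integrableOn_rpow_mul_exp_rectangle (p := p) hu huv hT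
  rw [IntegrableOn, Measure.volume_eq_prod, ← Measure.prod_restrict] at h
  have h2 := h.integral_prod_left
  rw [intervalIntegrable_iff, IntegrableOn]
  refine h2.congr (Eventually.of_forall fun t => ?_)
  simp only [Function.uncurry_apply_pair]
  rw [intervalIntegral.integral_of_le huv, uIoc_of_le huv]

theorem integral_exp_neg_mul_interval {y : ℝ} (hy : 0 < y) (T : ℝ) :
    ∫ t in (0 : ℝ)..T, Real.exp (-y * t) = (1 - Real.exp (-y * T)) / y := by
  have : ∀ t ∈ uIcc (0 : ℝ) T,
      HasDerivAt (fun t => -(Real.exp (-y * t) / y)) (Real.exp (-y * t)) t := by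
    intro t _
    have h := (((hasDerivAt_id' t).const_mul (-y)).exp.div_const y).neg
    refine h.congr_deriv ?_
    field_simp
  rw [intervalIntegral.integral_eq_sub_of_hasDerivAt this (by
    exact Continuous.intervalIntegrable (by fun_prop) _ _)]
  simp only [mul_zero, Real.exp_zero]
  ring

theorem integral_rpow_mul_exp_interval {y h : ℝ} (hy : 0 < y) (T : ℝ) :
    ∫ t in (0 : ℝ)..T, y ^ (-h) * Real.exp (-y * t)
      = y ^ (-(1 + h)) - y ^ (-(1 + h)) * Real.exp (-y * T) := by
  rw [intervalIntegral.integral_const_mul, integral_exp_neg_mul_interval hy,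
    show -(1 + h) = -h - 1 by ring, Real.rpow_sub_one hy.ne']
  ring

/-- Up to sign `T_m(-cosh L)` is `cosh (m L)`, which is at least `exp (m L) / 2`. -/
theorem chebyshev_sq_neg_cosh_ge (m : ℕ) (L : ℝ) :
    Real.exp (2 * m * L) / 4 ≤ (Chebyshev.T ℝ m).eval (-Real.cosh L) ^ 2 := by
  rw [Chebyshev.T_eval_neg, Chebyshev.T_real_cosh, mul_pow]
  have h1 : ((((m : ℤ).negOnePow : ℤˣ) : ℤ) : ℝ) ^ 2 = 1 := by
    rcases Int.units_eq_one_or ((m : ℤ).negOnePow) with h | h <;> rw [h] <;> norm_num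
  have h2 : Real.exp (2 * m * L) / 4 = (Real.exp (m * L) / 2) ^ 2 := by
    rw [div_pow, ← Real.exp_nat_mul]; push_cast; ring_nf
  rw [h1, one_mul, h2]
  have h3 : Real.exp (m * L) / 2 ≤ Real.cosh (((m : ℤ) : ℝ) * L) := by
    rw [Real.cosh_eq, Int.cast_natCast]
    have := Real.exp_pos (-(m * L))
    linarith
  gcongr

/-- The `L¹`-error on a later interval `[u, q u]`. -/
theorem IsGaussQuadrature.integral_error_le {m : ℕ} {x ω : Fin m → ℝ} {u q h T L : ℝ}
    (hQ : IsGaussQuadrature (fun _ => 1) u (q * u) m x ω) (hm : 0 < m) (hu : 0 < u) (hq : 1 < q)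
    (hh : 0 < h) (hT : 0 ≤ T) (hL : 0 < L) (hz : Real.cosh L < (q + 1) / (q - 1)) :
    ∫ t in (0 : ℝ)..T, ((∫ y in u..q * u, y ^ (-h) * Real.exp (-y * t))
        - ∑ j, ω j * (x j ^ (-h) * Real.exp (-x j * t)))
      ≤ u ^ (-h) * ((h / (Real.exp 1 * (((q + 1) - (q - 1) * Real.cosh L) / 2))) ^ h
          / Real.Gamma (1 + h)
        * (4 * Real.exp (-(2 * m * L)) * (Real.log ((Real.cosh L + 1) / (Real.cosh L - 1)) / 2
          + 1 / ((2 * m - 1) * (Real.cosh L - 1))))) := by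
  have huv : u ≤ q * u := by nlinarith
  have huv' : u < q * u := by nlinarith
  set z := Real.cosh L with hzdef
  have hz1 : 1 < z := Real.one_lt_cosh.2 hL.ne'
  -- The affine map of `[u, q u]` onto `[-1, 1]` sends `u δ` to `-z = -cosh L` and `0` to
  -- `-(q+1)/(q-1)`. Hence `hz` says that the pole lies to the right of the singularity `0`.
  set δ := ((q + 1) - (q - 1) * z) / 2 with hδdef
  have hq1 : 0 < q - 1 := by linarith
  have hδ0 : 0 < δ := by
    rw [lt_div_iff₀ hq1] at hz
    rw [hδdef]; linarith
  have hδ1 : δ < 1 := by rw [hδdef]; nlinarith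
  have hΓ : 0 < Real.Gamma (1 + h) := Real.Gamma_pos_of_pos (by linarith)
  have hxpos : ∀ j, 0 < x j := fun j => hu.trans_le (hQ.mem_Icc j).1
  have hswap : ∫ t in (0 : ℝ)..T, ((∫ y in u..q * u, y ^ (-h) * Real.exp (-y * t))
        - ∑ j, ω j * (x j ^ (-h) * Real.exp (-x j * t)))
      = ((∫ y in u..q * u, y ^ (-(1 + h))) - ∑ j, ω j * x j ^ (-(1 + h)))
        - ((∫ y in u..q * u, y ^ (-(1 + h)) * Real.exp (-y * T))
          - ∑ j, ω j * (x j ^ (-(1 + h)) * Real.exp (-x j * T))) := by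
    rw [intervalIntegral.integral_sub (intervalIntegrable_integral_rpow_mul_exp hu huv hT)
      (Continuous.intervalIntegrable (by fun_prop) _ _),
      intervalIntegral_intervalIntegral_swap (integrableOn_rpow_mul_exp_rectangle hu huv hT),
      intervalIntegral.integral_finsetSum
        (fun j _ => Continuous.intervalIntegrable (by fun_prop) _ _)]
    have e1 : (∫ y in u..q * u, ∫ t in (0 : ℝ)..T, y ^ (-h) * Real.exp (-y * t))
        = (∫ y in u..q * u, y ^ (-(1 + h)))
          - ∫ y in u..q * u, y ^ (-(1 + h)) * Real.exp (-y * T) := by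
      have hc : ∀ y ∈ uIcc u (q * u), ContinuousAt (fun y : ℝ => y ^ (-(1 + h))) y := by
        intro y hy
        rw [uIcc_of_le huv] at hy
        exact Real.continuousAt_rpow_const _ _ (Or.inl (hu.trans_le hy.1).ne')
      rw [← intervalIntegral.integral_sub]
      · refine intervalIntegral.integral_congr fun y hy => ?_
        rw [uIcc_of_le huv] at hy
        exact integral_rpow_mul_exp_interval (hu.trans_le hy.1) T
      · exact ContinuousOn.intervalIntegrable fun y hy => (hc y hy).continuousWithinAt
      · exact ContinuousOn.intervalIntegrable fun y hy =>
          ((hc y hy).mul (by fun_prop)).continuousWithinAt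
    have e2 : ∑ j, ∫ t in (0 : ℝ)..T, ω j * (x j ^ (-h) * Real.exp (-x j * t))
        = ∑ j, ω j * x j ^ (-(1 + h))
          - ∑ j, ω j * (x j ^ (-(1 + h)) * Real.exp (-x j * T)) := by
      rw [← Finset.sum_sub_distrib]
      refine Finset.sum_congr rfl fun j _ => ?_
      rw [intervalIntegral.integral_const_mul, integral_rpow_mul_exp_interval (hxpos j)]
      ring
    rw [e1, e2]; ring
  -- The contribution of the end time `T` is itself a nonnegative quadrature error, entering `hswap`
  -- with a minus sign; it can be dropped, which makes the bound independent of `T`.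
  have hpos := hQ.sum_rpow_mul_exp_le hu huv (by linarith : 0 < 1 + h) hT
  have hcmp := hQ.integral_rpow_sub_sum_le hu huv hh (mul_pos hu hδ0)
    (by nlinarith : u * δ < u)
  -- the comparison polynomial
  set c : ℝ := 2 / (q * u - u) with hc
  have hcpos : 0 < c := div_pos two_pos (by linarith)
  set d : ℝ := -((q + 1) / (q - 1)) with hd
  set S : ℝ[X] := (Chebyshev.T ℝ m).comp (C c * X + C d) ^ 2 with hS
  have hSe : ∀ y, S.eval y = (Chebyshev.T ℝ m).eval (c * y + d) ^ 2 := by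
    intro y; simp [hS, eval_comp]
  have hSdeg : S.natDegree ≤ 2 * m := by
    rw [hS]
    refine natDegree_pow_le.trans ?_
    gcongr
    refine natDegree_comp_le.trans ?_
    rw [Chebyshev.natDegree_T, Int.natAbs_natCast]
    calc m * (C c * X + C d).natDegree ≤ m * 1 := by
          gcongr; exact natDegree_linear_le
      _ = m := mul_one m
  have hcd : c * (u * δ) + d = -z := by
    rw [hc, hd, hδdef, show q * u - u = u * (q - 1) by ring]
    field_simp
    ring
  have hSδ : Real.exp (2 * m * L) / 4 ≤ S.eval (u * δ) := by
    rw [hSe, hcd]; exact chebyshev_sq_neg_cosh_ge m L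
  have hSδ0 : 0 < S.eval (u * δ) := lt_of_lt_of_le (by positivity) hSδ
  have hinv := hQ.integral_inv_sub_sum_le huv (by nlinarith : u * δ < u) hm S hSdeg
    (fun y _ => by rw [hSe]; positivity) hSδ0
  have hsub : ∫ y in u..q * u, S.eval y / (y - u * δ)
      = ∫ y in (-1 : ℝ)..1, (Chebyshev.T ℝ m).eval y ^ 2 / (y + z) := by
    have e : ∀ y, S.eval y / (y - u * δ)
        = c * ((Chebyshev.T ℝ m).eval (c * y + d) ^ 2 / ((c * y + d) + z)) := by
      intro y
      rw [hSe, show (c * y + d) + z = c * (y - u * δ) by linarith]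
      generalize y - u * δ = D
      field_simp
    simp only [e]
    rw [intervalIntegral.integral_const_mul,
      intervalIntegral.integral_comp_mul_add
        (fun y => (Chebyshev.T ℝ m).eval y ^ 2 / (y + z)) hcpos.ne',
      smul_eq_mul, mul_inv_cancel_left₀ hcpos.ne']
    congr 1
    · rw [hc, hd, show q * u - u = u * (q - 1) by ring]; field_simp; ring
    · rw [hc, hd, show q * u - u = u * (q - 1) by ring]; field_simp; ring
  rw [hsub] at hinv
  have hJ := integral_chebyshev_sq_div_le m hm hz1
  set J := Real.log ((z + 1) / (z - 1)) / 2 + 1 / ((2 * m - 1) * (z - 1)) with hJdef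
  have hJint0 : 0 ≤ ∫ y in (-1 : ℝ)..1, (Chebyshev.T ℝ m).eval y ^ 2 / (y + z) :=
    intervalIntegral.integral_nonneg (by norm_num) fun y hy =>
      div_nonneg (sq_nonneg _) (by linarith [hy.1])
  have hfin : (∫ y in u..q * u, 1 / (y - u * δ)) - ∑ j, ω j * (1 / (x j - u * δ))
      ≤ 4 * Real.exp (-(2 * m * L)) * J := by
    refine hinv.trans ?_
    calc _ ≤ J / (Real.exp (2 * m * L) / 4) :=
          div_le_div₀ (hJint0.trans hJ) hJ (by positivity) hSδ
      _ = _ := by rw [Real.exp_neg]; field_simp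
  have hK : (h / (Real.exp 1 * (u * δ))) ^ h / Real.Gamma (1 + h)
      = u ^ (-h) * ((h / (Real.exp 1 * δ)) ^ h / Real.Gamma (1 + h)) := by
    rw [show h / (Real.exp 1 * (u * δ)) = u⁻¹ * (h / (Real.exp 1 * δ)) by field_simp,
      Real.mul_rpow (by positivity) (by positivity), Real.inv_rpow hu.le, ← Real.rpow_neg hu.le]
    ring
  rw [hK] at hcmp
  have hK0 : 0 ≤ u ^ (-h) * ((h / (Real.exp 1 * δ)) ^ h / Real.Gamma (1 + h)) := by positivity
  have := mul_le_mul_of_nonneg_left hfin hK0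
  rw [hswap]
  rw [mul_assoc (u ^ (-h)), mul_assoc (u ^ (-h))] at *
  linarith

/-- The remainder series is dominated termwise because `k! n! ≤ (k+n)!`. -/
theorem abs_exp_sub_sum_le (y : ℝ) (n : ℕ) :
    |Real.exp y - ∑ k ∈ Finset.range n, y ^ k / k.factorial|
      ≤ |y| ^ n / n.factorial * Real.exp |y| := by
  have hs := NormedSpace.expSeries_div_hasSum_exp y
  have hs' := NormedSpace.expSeries_div_hasSum_exp |y|
  rw [← Real.exp_eq_exp_ℝ] at hs hs'
  have h1 : Real.exp y - ∑ k ∈ Finset.range n, y ^ k / k.factorial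
      = ∑' k : ℕ, y ^ (k + n) / (k + n).factorial := by
    rw [← hs.tsum_eq, ← hs.summable.sum_add_tsum_nat_add n]; ring
  rw [h1, ← Real.norm_eq_abs (∑' _, _)]
  refine tsum_of_norm_bounded (hs'.mul_left (|y| ^ n / n.factorial)) fun k => ?_
  rw [norm_div, norm_pow, Real.norm_eq_abs, Real.norm_of_nonneg (by positivity), div_mul_div_comm,
    pow_add, mul_comm (|y| ^ k)]
  gcongr
  rw [add_comm]
  exact_mod_cast Nat.le_of_dvd (Nat.factorial_pos _) (Nat.factorial_mul_factorial_dvd_factorial_add n k)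

/-- The Gaussian quadrature error of an exponential on an interval `[0, v]`. -/
theorem IsGaussQuadrature.abs_integral_exp_sub_sum_le {w : ℝ → ℝ} {v : ℝ} {m : ℕ}
    {x ω : Fin m → ℝ} (hQ : IsGaussQuadrature w 0 v m x ω) (hm : 0 < m) (hv : 0 ≤ v)
    (hw : IntervalIntegrable w volume 0 v) (hw0 : ∀ y ∈ Icc 0 v, 0 ≤ w y) {t : ℝ} (ht : 0 ≤ t) :
    |(∫ y in 0..v, Real.exp (-y * t) * w y) - ∑ j, ω j * Real.exp (-x j * t)|
      ≤ 2 * ((v * t / 2) ^ (2 * m) / (2 * m).factorial) * ∫ y in 0..v, w y := by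
  set c := v / 2 with hc
  -- The Taylor polynomial about the midpoint `c = v/2`: this halves the distance to be covered, and
  -- the prefactor `exp (-c t)` cancels the growth `exp (c t)` in the remainder bound. The factor
  -- `2` in the conclusion counts the integral and the quadrature sum once each.
  set p : ℝ[X] := C (Real.exp (-(c * t))) * ∑ k ∈ Finset.range (2 * m),
    C ((k.factorial : ℝ)⁻¹) * (C (-t) * (X - C c)) ^ k with hp
  have hpe : ∀ y, p.eval y = Real.exp (-(c * t)) * ∑ k ∈ Finset.range (2 * m),
      (-t * (y - c)) ^ k / k.factorial := by
    intro y
    simp only [hp, eval_mul, eval_C, eval_finsetSum, eval_pow, eval_sub, eval_X]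
    congr 1
    exact Finset.sum_congr rfl fun k _ => by ring
  have hdeg : p.degree < ((2 * m : ℕ) : WithBot ℕ) := by
    rw [hp, ← smul_eq_C_mul]
    refine (degree_smul_le _ _).trans_lt ((degree_sum_le _ _).trans_lt ?_)
    rw [Finset.sup_lt_iff (WithBot.bot_lt_coe _)]
    intro k hk
    rw [← smul_eq_C_mul]
    refine (degree_smul_le _ _).trans_lt ?_
    refine lt_of_le_of_lt degree_le_natDegree ?_
    have h1 : ((C (-t) * (X - C c)) ^ k).natDegree ≤ k * 1 := by
      refine natDegree_pow_le.trans ?_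
      gcongr
      exact (natDegree_C_mul_le _ _).trans (by simp)
    have := Finset.mem_range.1 hk
    exact_mod_cast (by omega : ((C (-t) * (X - C c)) ^ k).natDegree < 2 * m)
  set B := (v * t / 2) ^ (2 * m) / (2 * m).factorial with hB
  have hbound : ∀ y ∈ Icc 0 v, |Real.exp (-y * t) - p.eval y| ≤ B := by
    intro y hy
    have hyc : |-t * (y - c)| ≤ c * t := by
      rw [abs_mul, abs_neg, abs_of_nonneg ht, mul_comm]
      refine mul_le_mul_of_nonneg_right ?_ ht
      rw [abs_le]; constructor <;> linarith [hy.1, hy.2]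
    have hct : 0 ≤ c * t := by positivity
    have h1 : Real.exp (-y * t) - p.eval y = Real.exp (-(c * t))
        * (Real.exp (-t * (y - c)) - ∑ k ∈ Finset.range (2 * m), (-t * (y - c)) ^ k / k.factorial) := by
      rw [hpe, mul_sub (Real.exp _), ← Real.exp_add]
      congr 2; ring
    rw [h1, abs_mul, Real.abs_exp]
    calc Real.exp (-(c * t)) * |Real.exp (-t * (y - c))
          - ∑ k ∈ Finset.range (2 * m), (-t * (y - c)) ^ k / k.factorial|
        ≤ Real.exp (-(c * t)) * (|-t * (y - c)| ^ (2 * m) / (2 * m).factorial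
          * Real.exp |-t * (y - c)|) := by
          gcongr; exact abs_exp_sub_sum_le _ _
      _ ≤ Real.exp (-(c * t)) * ((c * t) ^ (2 * m) / (2 * m).factorial * Real.exp (c * t)) := by
          gcongr
      _ = B := by
          rw [mul_comm, mul_assoc, ← Real.exp_add, add_neg_cancel, Real.exp_zero, mul_one, hB, hc]
          ring_nf
  have hex := hQ.exact_of_degree_lt p hdeg
  have hω := hQ.weight_nonneg hv hw0
  have hsum := hQ.sum_weight hm
  have h1 : |∫ y in 0..v, (Real.exp (-y * t) - p.eval y) * w y| ≤ B * ∫ y in 0..v, w y := by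
    rw [← intervalIntegral.integral_const_mul]
    refine (intervalIntegral.abs_integral_le_integral_abs hv).trans ?_
    have hi : IntervalIntegrable (fun y => (Real.exp (-y * t) - p.eval y) * w y) volume 0 v :=
      hw.continuousOn_mul
        (Continuous.continuousOn ((by fun_prop : Continuous fun y => Real.exp (-y * t)).sub
          p.continuous))
    refine intervalIntegral.integral_mono_on hv hi.abs (hw.const_mul _) fun y hy => ?_
    rw [abs_mul, abs_of_nonneg (hw0 y hy)]
    exact mul_le_mul_of_nonneg_right (hbound y hy) (hw0 y hy)
  have h2 : |∑ j, ω j * (Real.exp (-x j * t) - p.eval (x j))| ≤ B * ∫ y in 0..v, w y := by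
    rw [← hsum, Finset.mul_sum]
    refine (Finset.abs_sum_le_sum_abs _ _).trans (Finset.sum_le_sum fun j _ => ?_)
    rw [abs_mul, abs_of_nonneg (hω j), mul_comm]
    exact mul_le_mul_of_nonneg_right (hbound _ (hQ.mem_Icc j)) (hω j)
  have h3 : ∫ y in 0..v, (Real.exp (-y * t) - p.eval y) * w y
      = (∫ y in 0..v, Real.exp (-y * t) * w y) - ∑ j, ω j * p.eval (x j) := by
    rw [← hex, ← intervalIntegral.integral_sub]
    · simp only [sub_mul]
    · exact hw.continuousOn_mul (by fun_prop)
    · exact hw.continuousOn_mul p.continuous.continuousOn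
  have h4 : ∑ j, ω j * (Real.exp (-x j * t) - p.eval (x j))
      = ∑ j, ω j * Real.exp (-x j * t) - ∑ j, ω j * p.eval (x j) := by
    simp only [mul_sub, Finset.sum_sub_distrib]
  rw [h3] at h1
  rw [h4] at h2
  rw [abs_le] at *
  constructor <;> linarith [h1.1, h1.2, h2.1, h2.2]

theorem integrable_rpow_mul_exp_tail {X T h : ℝ} (hX : 0 < X) (hh : 0 < h) (hT : 0 ≤ T) :
    Integrable (Function.uncurry fun t y : ℝ => y ^ (-h) * Real.exp (-y * t))
      ((volume.restrict (Ι 0 T)).prod (volume.restrict (Ioi X))) := by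
  have hmeas : AEStronglyMeasurable (Function.uncurry fun t y : ℝ => y ^ (-h) * Real.exp (-y * t))
      ((volume.restrict (Ι 0 T)).prod (volume.restrict (Ioi X))) :=
    Measurable.aestronglyMeasurable (by unfold Function.uncurry; fun_prop)
  have hpos : ∀ y ∈ Ioi X, 0 < y := fun y hy => hX.trans hy
  rw [integrable_prod_iff' hmeas]
  constructor
  · refine Eventually.of_forall fun y => ?_
    rw [uIoc_of_le hT]
    exact (Continuous.integrableOn_Ioc (by
      simp only [Function.uncurry_apply_pair]; fun_prop))
  · have hdom : IntegrableOn (fun y : ℝ => y ^ (-(1 + h))) (Ioi X) :=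
      integrableOn_Ioi_rpow_of_lt (by linarith) hX
    refine Integrable.mono hdom (hmeas.norm.prod_swap.integral_prod_right') ?_
    refine ae_restrict_of_forall_mem measurableSet_Ioi fun y hy => ?_
    have hy0 := hpos y hy
    have e : ∫ t in Ι 0 T, ‖Function.uncurry (fun t y : ℝ => y ^ (-h) * Real.exp (-y * t)) (t, y)‖
        = y ^ (-(1 + h)) - y ^ (-(1 + h)) * Real.exp (-y * T) := by
      rw [← integral_rpow_mul_exp_interval hy0, intervalIntegral.integral_of_le hT,
        uIoc_of_le hT]
      refine integral_congr_ae (Eventually.of_forall fun t => ?_)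
      simp only [Function.uncurry_apply_pair]
      exact Real.norm_of_nonneg (by positivity)
    have h1 : 0 ≤ y ^ (-(1 + h)) * Real.exp (-y * T) := by positivity
    have h2 : y ^ (-(1 + h)) * Real.exp (-y * T) ≤ y ^ (-(1 + h)) :=
      mul_le_of_le_one_right (by positivity) (Real.exp_le_one_iff.2 (by nlinarith))
    rw [e, Real.norm_of_nonneg (by linarith), Real.norm_of_nonneg (by positivity)]
    linarith

/-- Integrating in time first replaces `y^(-h) e^(-yt)` by at most `y^(-1-h)`, which is integrable
at infinity. -/
theorem integral_tail_le {X T h : ℝ} (hX : 0 < X) (hh : 0 < h) (hT : 0 ≤ T) :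
    IntervalIntegrable (fun t => ∫ y in Ioi X, y ^ (-h) * Real.exp (-y * t)) volume 0 T ∧
    ∫ t in (0 : ℝ)..T, (∫ y in Ioi X, y ^ (-h) * Real.exp (-y * t)) ≤ X ^ (-h) / h := by
  have hi := integrable_rpow_mul_exp_tail hX hh hT
  refine ⟨?_, ?_⟩
  · rw [intervalIntegrable_iff]
    exact hi.integral_prod_left
  · rw [intervalIntegral_integral_swap hi]
    have hdom : IntegrableOn (fun y : ℝ => y ^ (-(1 + h))) (Ioi X) :=
      integrableOn_Ioi_rpow_of_lt (by linarith) hX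
    calc ∫ y in Ioi X, ∫ t in (0 : ℝ)..T, y ^ (-h) * Real.exp (-y * t)
        ≤ ∫ y in Ioi X, y ^ (-(1 + h)) := by
          refine setIntegral_mono_on ?_ hdom measurableSet_Ioi fun y hy => ?_
          · simp only [intervalIntegral.integral_of_le hT, ← uIoc_of_le hT]
            exact hi.integral_prod_right
          · have hy0 : 0 < y := hX.trans hy
            rw [integral_rpow_mul_exp_interval hy0]
            have : 0 ≤ y ^ (-(1 + h)) * Real.exp (-y * T) := by positivity
            linarith
      _ = X ^ (-h) / h := by
          rw [integral_Ioi_rpow_of_lt (by linarith) hX, show -(1 + h) + 1 = -h by ring]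
          field_simp

end RoughKernel

/-! ### Assembling the `L¹`-error of a geometric Gaussian rule. -/

namespace RoughKernel

open Polynomial MeasureTheory Set
open scoped Interval

theorem rd_pos (x : ℝ) : 0 < rd x := lt_of_lt_of_le one_pos (le_max_left _ _)

theorem cH_pos {H : ℝ} (hH : -(1 / 2) < H) (hH' : H < 1 / 2) : 0 < cH H := by
  have h1 : 0 < Real.Gamma (H + 1 / 2) := Real.Gamma_pos_of_pos (by linarith)
  have h2 : 0 < Real.Gamma (1 / 2 - H) := Real.Gamma_pos_of_pos (by linarith)
  unfold cH
  positivity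

theorem integrableOn_rpow_neg_mul_exp {h t : ℝ} (hh1 : h < 1) (ht : 0 < t) :
    IntegrableOn (fun y : ℝ => y ^ (-h) * Real.exp (-y * t)) (Ioi 0) := by
  have := integrableOn_rpow_mul_exp_neg_mul (a := 1 - h) (by linarith) ht
  refine this.congr_fun (fun y _ => ?_) measurableSet_Ioi
  simp only
  rw [show 1 - h - 1 = -h by ring, show -(t * y) = -y * t by ring]

/-- This is the Gamma integral with exponent `1/2 - H`, and it explains the normalization `c_H`. -/
theorem fracKernel_eq_integral {H t : ℝ} (hH : -(1 / 2) < H) (hH' : H < 1 / 2) (ht : 0 < t) :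
    fracKernel H t
      = cH H * ∫ y in Ioi (0 : ℝ), y ^ (-(H + 1 / 2)) * Real.exp (-y * t) := by
  have h1 : 0 < Real.Gamma (H + 1 / 2) := Real.Gamma_pos_of_pos (by linarith)
  have h2 : 0 < Real.Gamma (1 / 2 - H) := Real.Gamma_pos_of_pos (by linarith)
  have h3 := Real.integral_rpow_mul_exp_neg_mul_Ioi (a := 1 / 2 - H) (by linarith) ht
  have h4 : ∫ y in Ioi (0 : ℝ), y ^ (-(H + 1 / 2)) * Real.exp (-y * t)
      = ∫ y in Ioi (0 : ℝ), y ^ (1 / 2 - H - 1) * Real.exp (-(t * y)) := by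
    refine setIntegral_congr_fun measurableSet_Ioi fun y _ => ?_
    rw [show 1 / 2 - H - 1 = -(H + 1 / 2) by ring, show -(t * y) = -y * t by ring]
  rw [h4, h3, fracKernel, cH, one_div t, Real.inv_rpow ht.le, ← Real.rpow_neg ht.le,
    show -(1 / 2 - H) = H - 1 / 2 by ring]
  clear h3 h4
  generalize Real.Gamma (H + 1 / 2) = A at *
  generalize Real.Gamma (1 / 2 - H) = B at *
  field_simp

theorem sum_geometric_le {r : ℝ} (hr0 : 0 ≤ r) (hr1 : r < 1) (n : ℕ) :
    ∑ i ∈ Finset.range n, r ^ i ≤ 1 / (1 - r) := by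
  rw [one_div, ← tsum_geometric_of_lt_one hr0 hr1]
  exact (summable_geometric_of_lt_one hr0 hr1).sum_le_tsum _ fun i _ => pow_nonneg hr0 i

/-- The `L¹`-error of a geometric Gaussian rule, bounded by the contributions of the tail, of the
later intervals and of the first interval. -/
theorem GeometricGaussianRule.l1Error_le {H : ℝ} {N : ℕ} {α β a b T q L h : ℝ}
    (Q : GeometricGaussianRule H N α β a b) (hH : -(1 / 2) < H) (hH' : H < 1 / 2)
    (hh : h = H + 1 / 2) (hT : 0 < T) (hq : 1 < q) (hξ1 : 0 < xi H N α β a b 1)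
    (hξ : ∀ i, xi H N α β a b (i + 2) = q * xi H N α β a b (i + 1))
    (hL : 0 < L) (hz : Real.cosh L < (q + 1) / (q - 1)) :
    Q.l1Error T ≤ cH H * (xi H N α β a b (numIntervals H N β) ^ (-h) / h
      + xi H N α β a b 1 ^ (-h) / (1 - q ^ (-h))
        * ((h / (Real.exp 1 * (((q + 1) - (q - 1) * Real.cosh L) / 2))) ^ h
          / Real.Gamma (1 + h)
        * (4 * Real.exp (-(2 * level H N β * L))
          * (Real.log ((Real.cosh L + 1) / (Real.cosh L - 1)) / 2
          + 1 / ((2 * level H N β - 1) * (Real.cosh L - 1))))))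
      + 2 * ((xi H N α β a b 1 * T / 2) ^ (2 * level H N β) / (2 * level H N β).factorial)
        * (cH H * (xi H N α β a b 1 ^ (1 - h) / (1 - h))) * T := by
  set ξ := xi H N α β a b with hξdef
  set n := numIntervals H N β with hn
  set m := level H N β with hm
  set B := (h / (Real.exp 1 * (((q + 1) - (q - 1) * Real.cosh L) / 2))) ^ h
          / Real.Gamma (1 + h)
        * (4 * Real.exp (-(2 * m * L))
          * (Real.log ((Real.cosh L + 1) / (Real.cosh L - 1)) / 2
          + 1 / ((2 * m - 1) * (Real.cosh L - 1)))) with hB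
  have hh0 : 0 < h := by linarith
  have hh1 : h < 1 := by linarith
  have hc := cH_pos hH hH'
  have hn0 : 0 < n := rd_pos _
  have hm0 : 0 < m := rd_pos _
  have hH2 : -H - 1 / 2 = -h := by rw [hh]; ring
  have hq0 : 0 < q := by linarith
  have hξ0 : ξ 0 = 0 := by simp [hξdef, xi]
  have hξs : ∀ i, ξ (i + 1) = ξ 1 * q ^ i := by
    intro i
    induction i with
    | zero => simp
    | succ i ih => rw [hξ i, ih]; ring
  have hξpos : ∀ i, 0 < ξ (i + 1) := fun i => by rw [hξs]; positivity
  have hξmono : ∀ i, ξ i ≤ ξ (i + 1) := by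
    rintro (_ | i)
    · rw [hξ0]; exact hξ1.le
    · rw [hξ i]; nlinarith [hξpos i]
  have hξnn : ∀ i, 0 ≤ ξ i := by
    rintro (_ | i)
    · exact hξ0.ge
    · exact (hξpos i).le
  have hξn : 0 < ξ n := by
    obtain ⟨k, hk⟩ := Nat.exists_eq_succ_of_ne_zero hn0.ne'
    rw [hk]; exact hξpos k
  have hB0 : 0 ≤ B := by
    have h1 : 1 < Real.cosh L := Real.one_lt_cosh.2 hL.ne'
    have hq1 : 0 < q - 1 := by linarith
    have h2 : 0 ≤ (q + 1 - (q - 1) * Real.cosh L) / 2 := by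
      rw [lt_div_iff₀ hq1] at hz; linarith
    have h3 : 0 ≤ Real.log ((Real.cosh L + 1) / (Real.cosh L - 1)) :=
      Real.log_nonneg ((one_le_div (by linarith)).2 (by linarith))
    have h4 : (0 : ℝ) ≤ 2 * m - 1 := by
      have : (1 : ℝ) ≤ m := by exact_mod_cast hm0
      linarith
    have h5 : 0 ≤ Real.cosh L - 1 := by linarith
    have h6 : 0 < Real.Gamma (1 + h) := Real.Gamma_pos_of_pos (by linarith)
    rw [hB]; positivity
  -- the error on the single intervals
  set E : Fin n → ℝ → ℝ := fun i t => cH H * (∫ y in ξ i..ξ (i + 1), y ^ (-h) * Real.exp (-y * t))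
    - ∑ j, Q.weight i j * Real.exp (-Q.node i j * t) with hE
  have hdecomp : ∀ t, 0 < t → fracKernel H t - Q.kernel t
      = ∑ i, E i t + cH H * ∫ y in Ioi (ξ n), y ^ (-h) * Real.exp (-y * t) := by
    intro t ht
    have hi := integrableOn_rpow_neg_mul_exp hh1 ht
    have hii : ∀ k, IntervalIntegrable (fun y : ℝ => y ^ (-h) * Real.exp (-y * t)) volume
        (ξ k) (ξ (k + 1)) := by
      intro k
      rw [intervalIntegrable_iff, uIoc_of_le (hξmono k)]
      exact hi.mono_set fun y hy => (hξnn k).trans_lt hy.1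
    have h1 : ∫ y in Ioi (0 : ℝ), y ^ (-h) * Real.exp (-y * t)
        = (∑ k ∈ Finset.range n, ∫ y in ξ k..ξ (k + 1), y ^ (-h) * Real.exp (-y * t))
          + ∫ y in Ioi (ξ n), y ^ (-h) * Real.exp (-y * t) := by
      rw [intervalIntegral.sum_integral_adjacent_intervals fun k _ => hii k, hξ0,
        intervalIntegral.integral_interval_add_Ioi hi (hi.mono_set (Ioi_subset_Ioi hξn.le))]
    rw [fracKernel_eq_integral hH hH' ht, ← hh, h1, GeometricGaussianRule.kernel, mul_add,
      Finset.sum_range, Finset.mul_sum, hE, Finset.sum_sub_distrib]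
    ring
  -- the first interval
  set B0 := 2 * ((ξ 1 * T / 2) ^ (2 * m) / (2 * m).factorial)
        * (cH H * (ξ 1 ^ (1 - h) / (1 - h))) with hB0def
  have hE0 : ∀ i : Fin n, (i : ℕ) = 0 → ∀ t ∈ Icc 0 T, |E i t| ≤ B0 := by
    intro i hi t ht
    have hQ := Q.isGauss_first i hi
    rw [← hξdef, hξ0, hH2] at hQ
    have hwi : IntervalIntegrable (fun y : ℝ => cH H * y ^ (-h)) volume 0 (ξ 1) :=
      (intervalIntegral.intervalIntegrable_rpow' (by linarith)).const_mul _
    have := hQ.abs_integral_exp_sub_sum_le hm0 hξ1.le hwi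
      (fun y hy => mul_nonneg hc.le (Real.rpow_nonneg hy.1 _)) ht.1
    have e1 : E i t = (∫ y in 0..ξ 1, Real.exp (-y * t) * (cH H * y ^ (-h)))
        - ∑ j, Q.gaussWeight i j * Real.exp (-Q.node i j * t) := by
      simp only [hE, GeometricGaussianRule.weight, hi, if_true, hξ0, zero_add]
      rw [← intervalIntegral.integral_const_mul]
      congr 2
      ext y; ring
    have e2 : ∫ y in 0..ξ 1, cH H * y ^ (-h) = cH H * (ξ 1 ^ (1 - h) / (1 - h)) := by
      rw [intervalIntegral.integral_const_mul, integral_rpow (Or.inl (by linarith)),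
        Real.zero_rpow (by linarith), show -h + 1 = 1 - h by ring, sub_zero]
    rw [e1]
    refine this.trans ?_
    rw [e2, hB0def]
    have : 0 ≤ 1 - h := by linarith
    have ht0 := ht.1
    have ht1 := ht.2
    gcongr
  -- the later intervals
  have hEl : ∀ i : Fin n, (i : ℕ) ≠ 0 → (∀ t ∈ Icc 0 T, 0 ≤ E i t) ∧
      IntervalIntegrable (E i) volume 0 T ∧
      ∫ t in (0 : ℝ)..T, E i t ≤ cH H * (ξ i ^ (-h) * B) := by
    intro i hi
    obtain ⟨k, hk⟩ := Nat.exists_eq_succ_of_ne_zero hi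
    have hQ := Q.isGauss_later i hi
    have hstep : ξ (i + 1) = q * ξ i := by rw [hk]; exact hξ k
    have hui : 0 < ξ i := by rw [hk]; exact hξpos k
    rw [← hξdef, hstep] at hQ
    have huv : ξ i ≤ q * ξ i := by nlinarith
    have e1 : E i = fun t => cH H * ((∫ y in ξ i..q * ξ i, y ^ (-h) * Real.exp (-y * t))
        - ∑ j, Q.gaussWeight i j * (Q.node i j ^ (-h) * Real.exp (-Q.node i j * t))) := by
      ext t
      simp only [hE, GeometricGaussianRule.weight, hi, if_false, hstep, hH2]
      rw [mul_sub, Finset.mul_sum]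
      congr 1
      exact Finset.sum_congr rfl fun j _ => by ring
    rw [e1]
    refine ⟨fun t ht => ?_, ?_, ?_⟩
    · have := hQ.sum_rpow_mul_exp_le hui huv hh0 ht.1
      exact mul_nonneg hc.le (by linarith)
    · exact ((intervalIntegrable_integral_rpow_mul_exp hui huv hT.le).sub
        (Continuous.intervalIntegrable (by fun_prop) _ _)).const_mul _
    · rw [intervalIntegral.integral_const_mul]
      exact mul_le_mul_of_nonneg_left
        (hQ.integral_error_le hm0 hui hq hh0 hT.le hL hz) hc.le
  -- The first interval is bounded uniformly in time; on the later ones the error equals its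
  -- absolute value, so it serves as its own majorant.
  set G : Fin n → ℝ → ℝ := fun i t => if (i : ℕ) = 0 then B0 else E i t with hG
  have hGi : ∀ i, IntervalIntegrable (G i) volume 0 T := by
    intro i
    by_cases hi : (i : ℕ) = 0
    · simp only [hG, hi, if_true]; exact intervalIntegrable_const
    · simp only [hG, hi, if_false]; exact (hEl i hi).2.1
  have hEG : ∀ i, ∀ t ∈ Icc 0 T, |E i t| ≤ G i t := by
    intro i t ht
    by_cases hi : (i : ℕ) = 0
    · simp only [hG, hi, if_true]; exact hE0 i hi t ht
    · simp only [hG, hi, if_false]; exact (abs_of_nonneg ((hEl i hi).1 t ht)).le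
  obtain ⟨htaili, htail⟩ := integral_tail_le hξn hh0 hT.le
  have hK : IntervalIntegrable (fun t => |fracKernel H t - Q.kernel t|) volume 0 T := by
    refine IntervalIntegrable.abs (IntervalIntegrable.sub ?_ ?_)
    · exact (intervalIntegral.intervalIntegrable_rpow' (by linarith)).div_const _
    · exact Continuous.intervalIntegrable (by unfold GeometricGaussianRule.kernel; fun_prop) _ _
  have hsumi : IntervalIntegrable (fun t => ∑ i, G i t) volume 0 T := by
    have := IntervalIntegrable.sum Finset.univ (f := G) fun i _ => hGi i
    simpa only [Finset.sum_fn] using this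
  have hmain : Q.l1Error T ≤ ∑ i, (∫ t in (0 : ℝ)..T, G i t)
      + cH H * ∫ t in (0 : ℝ)..T, (∫ y in Ioi (ξ n), y ^ (-h) * Real.exp (-y * t)) := by
    rw [← intervalIntegral.integral_const_mul, ← intervalIntegral.integral_finsetSum
      (fun i _ => hGi i), ← intervalIntegral.integral_add hsumi (htaili.const_mul _)]
    -- The Laplace representation needs `t > 0`, so the comparison is made on the open interval.
    refine intervalIntegral.integral_mono_on_of_le_Ioo hT.le hK
      (hsumi.add (htaili.const_mul _)) fun t ht => ?_
    rw [hdecomp t ht.1]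
    refine (abs_add_le _ _).trans (add_le_add ?_ (abs_of_nonneg ?_).le)
    · exact (Finset.abs_sum_le_sum_abs _ _).trans
        (Finset.sum_le_sum fun i _ => hEG i t ⟨ht.1.le, ht.2.le⟩)
    · refine mul_nonneg hc.le (setIntegral_nonneg measurableSet_Ioi fun y hy => ?_)
      have : 0 < y := hξn.trans hy
      positivity
  have hGint : ∀ i : Fin n, ∫ t in (0 : ℝ)..T, G i t
      ≤ if (i : ℕ) = 0 then B0 * T else cH H * (ξ i ^ (-h) * B) := by
    intro i
    by_cases hi : (i : ℕ) = 0
    · simp only [hG, hi, if_true, intervalIntegral.integral_const, smul_eq_mul]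
      linarith
    · simp only [hG, hi, if_false]; exact (hEl i hi).2.2
  have hq1 : q ^ (-h) < 1 := Real.rpow_lt_one_of_one_lt_of_neg hq (by linarith)
  have hsum : ∑ i : Fin n, (if (i : ℕ) = 0 then B0 * T else cH H * (ξ i ^ (-h) * B))
      ≤ cH H * (ξ 1 ^ (-h) / (1 - q ^ (-h)) * B) + B0 * T := by
    rw [← Finset.sum_range fun i => if i = 0 then B0 * T else cH H * (ξ i ^ (-h) * B)]
    obtain ⟨k, hk⟩ := Nat.exists_eq_succ_of_ne_zero hn0.ne'
    rw [hk, Finset.sum_range_succ']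
    simp only [if_true, Nat.succ_ne_zero, if_false]
    have e : ∀ i, cH H * (ξ (i + 1) ^ (-h) * B) = cH H * (ξ 1 ^ (-h) * B) * (q ^ (-h)) ^ i := by
      intro i
      rw [hξs, Real.mul_rpow hξ1.le (by positivity), ← Real.rpow_natCast q i,
        ← Real.rpow_natCast (q ^ (-h)) i, ← Real.rpow_mul hq0.le, ← Real.rpow_mul hq0.le,
        mul_comm (i : ℝ)]
      ring
    rw [Finset.sum_congr rfl fun i _ => e i, ← Finset.mul_sum]
    have := mul_le_mul_of_nonneg_left (sum_geometric_le (by positivity) hq1 k)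
      (by positivity : 0 ≤ cH H * (ξ 1 ^ (-h) * B))
    have e2 : cH H * (ξ 1 ^ (-h) / (1 - q ^ (-h)) * B)
        = cH H * (ξ 1 ^ (-h) * B) * (1 / (1 - q ^ (-h))) := by ring
    rw [e2]
    linarith
  calc Q.l1Error T ≤ _ := hmain
    _ ≤ (cH H * (ξ 1 ^ (-h) / (1 - q ^ (-h)) * B) + B0 * T) + cH H * (ξ n ^ (-h) / h) :=
        add_le_add ((Finset.sum_le_sum fun i _ => hGint i).trans hsum)
          (mul_le_mul_of_nonneg_left htail hc.le)
    _ = _ := by ring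

end RoughKernel

/-! ### The Gaussian rate and explicit bounds for the later intervals. -/

namespace RoughKernel

open Set

/-- The bound is `1` rather than `1/2` because values that round to `0` are raised to `1`. -/
theorem abs_rd_sub_le {x : ℝ} (hx : 0 ≤ x) : |(rd x : ℝ) - x| ≤ 1 := by
  have h1 := abs_sub_round x
  rw [abs_le] at h1
  unfold rd
  rcases le_or_gt 1 (round x) with h | h
  · have h2 : ((max 1 (round x).toNat : ℕ) : ℝ) = (round x : ℝ) := by
      have h3 : 1 ≤ (round x).toNat := by omega
      rw [max_eq_right h3]
      exact_mod_cast Int.toNat_of_nonneg (by omega)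
    rw [h2, abs_le]
    constructor <;> linarith [h1.1, h1.2]
  · have h3 : (round x).toNat ≤ 1 := by omega
    have h4 : ((round x : ℤ) : ℝ) ≤ 0 := by exact_mod_cast (by omega : round x ≤ 0)
    rw [max_eq_left h3, abs_le]
    push_cast
    constructor <;> linarith [h1.1, h1.2]

theorem exp_log_three_add : Real.exp (Real.log (3 + 2 * √2)) = 3 + 2 * √2 :=
  Real.exp_log (by positivity)

theorem exp_half_log_three_add : Real.exp (Real.log (3 + 2 * √2) / 2) = 1 + √2 := by
  have h : (3 : ℝ) + 2 * √2 = (1 + √2) ^ 2 := by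
    nlinarith [Real.sq_sqrt (show (0 : ℝ) ≤ 2 by norm_num)]
  rw [h, Real.log_pow]
  push_cast
  rw [mul_div_cancel_left₀ _ two_ne_zero, Real.exp_log (by positivity)]

theorem log_three_add_pos : 0 < Real.log (3 + 2 * √2) :=
  Real.log_pos (by linarith [Real.sqrt_nonneg 2])

/-- The logarithm of the convergence rate of Gaussian quadrature on an interval whose end points
have the ratio `exp v`, for functions with a singularity at `0`. -/
noncomputable def gaussRate (v : ℝ) : ℝ := Real.log ((Real.exp (v / 2) + 1) / (Real.exp (v / 2) - 1))

theorem exp_gaussRate {v : ℝ} (hv : 0 < v) :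
    Real.exp (gaussRate v) = (Real.exp (v / 2) + 1) / (Real.exp (v / 2) - 1) := by
  have h : 1 < Real.exp (v / 2) := Real.one_lt_exp_iff.2 (by linarith)
  exact Real.exp_log (div_pos (by linarith) (by linarith))

/-- The right side is the distance from the origin of the image of the singularity `0` when the
interval is mapped to `[-1, 1]`; thus `gaussRate v` is the value of `L` at which the pole would
reach `0`. -/
theorem cosh_gaussRate {v : ℝ} (hv : 0 < v) :
    Real.cosh (gaussRate v) = (Real.exp v + 1) / (Real.exp v - 1) := by
  have h : 1 < Real.exp (v / 2) := Real.one_lt_exp_iff.2 (by linarith)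
  have h2 : Real.exp v = Real.exp (v / 2) ^ 2 := by rw [← Real.exp_nat_mul]; congr 1; ring
  rw [Real.cosh_eq, Real.exp_neg, exp_gaussRate hv, h2]
  generalize Real.exp (v / 2) = s at *
  have h3 : s - 1 ≠ 0 := by linarith
  have h4 : s + 1 ≠ 0 := by linarith
  have h5 : s ^ 2 - 1 ≠ 0 := by nlinarith
  field_simp
  ring

/-- With `s = exp (v/2)`, clearing denominators leaves `(s - (1 + √2))² ≥ 0`. Equality at `s = 1 +
√2`, that is `v = log (3 + 2√2)`, singles out the optimal ratio and hence `α`. -/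
theorem exp_neg_gaussRate_le {v : ℝ} (hv : 0 < v) :
    Real.exp (-gaussRate v) ≤ Real.exp (v / 2 - Real.log (3 + 2 * √2)) := by
  have h : 1 < Real.exp (v / 2) := Real.one_lt_exp_iff.2 (by linarith)
  rw [Real.exp_neg, exp_gaussRate hv, Real.exp_sub, exp_log_three_add, inv_div]
  generalize Real.exp (v / 2) = s at *
  rw [div_le_div_iff₀ (by linarith) (by positivity)]
  nlinarith [sq_nonneg (s - (1 + √2)), Real.sq_sqrt (show (0 : ℝ) ≤ 2 by norm_num)]

theorem exp_gaussRate_log : Real.exp (gaussRate (Real.log (3 + 2 * √2))) = 1 + √2 := by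
  rw [exp_gaussRate log_three_add_pos, exp_half_log_three_add]
  have h : (0 : ℝ) < √2 := by positivity
  rw [show 1 + √2 - 1 = √2 by ring, div_eq_iff h.ne']
  nlinarith [Real.sq_sqrt (show (0 : ℝ) ≤ 2 by norm_num)]

theorem inv_one_add_sqrt_two : (1 + √2)⁻¹ = √2 - 1 := by
  rw [inv_eq_one_div, div_eq_iff (by positivity)]
  nlinarith [Real.sq_sqrt (show (0 : ℝ) ≤ 2 by norm_num)]

theorem sinh_gaussRate_log : Real.sinh (gaussRate (Real.log (3 + 2 * √2))) = 1 := by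
  rw [Real.sinh_eq, Real.exp_neg, exp_gaussRate_log, inv_one_add_sqrt_two]; ring

theorem cosh_gaussRate_log : Real.cosh (gaussRate (Real.log (3 + 2 * √2))) = √2 := by
  rw [Real.cosh_eq, Real.exp_neg, exp_gaussRate_log, inv_one_add_sqrt_two]; ring

theorem gaussRate_log_pos : 0 < gaussRate (Real.log (3 + 2 * √2)) := by
  rw [← Real.exp_lt_exp, exp_gaussRate_log, Real.exp_zero]
  linarith [show (0 : ℝ) < √2 by positivity]

theorem continuousAt_gaussRate {v : ℝ} (hv : 0 < v) : ContinuousAt gaussRate v := by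
  have h : 1 < Real.exp (v / 2) := Real.one_lt_exp_iff.2 (by linarith)
  have h1 : Real.exp (v / 2) - 1 ≠ 0 := by linarith
  unfold gaussRate
  refine ContinuousAt.log (ContinuousAt.div (by fun_prop) (by fun_prop) h1) ?_
  exact (div_pos (by linarith) (by linarith)).ne'

/-- The difference is `2 sinh (A - η/2) sinh (η/2)`, and `sinh x ≥ x`. It bounds from below the
distance of the shifted pole from `0`. -/
theorem cosh_sub_cosh_sub_ge {A η : ℝ} (hη : 0 ≤ η) (hA : η ≤ A) :
    η * Real.sinh (A - η / 2) ≤ Real.cosh A - Real.cosh (A - η) := by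
  have h1 : Real.cosh A - Real.cosh (A - η) = 2 * Real.sinh (A - η / 2) * Real.sinh (η / 2) := by
    have e1 := Real.cosh_add (A - η / 2) (η / 2)
    have e2 := Real.cosh_sub (A - η / 2) (η / 2)
    rw [sub_add_cancel] at e1
    rw [show A - η / 2 - η / 2 = A - η by ring] at e2
    rw [e1, e2]; ring
  have h2 : η / 2 ≤ Real.sinh (η / 2) := Real.self_le_sinh_iff.2 (by linarith)
  have h3 : 0 ≤ Real.sinh (A - η / 2) := Real.sinh_nonneg_iff.2 (by linarith)
  rw [h1]
  nlinarith

/-- The constant in the error bound for the later intervals. -/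
noncomputable def laterConst (h P v : ℝ) (m : ℕ) : ℝ :=
  (4 * (m / P) / ((10 * √2 - 14) * Real.exp v * (Real.exp v - 1)
      * Real.sinh (gaussRate v - h / (4 * m)))) ^ h
    * (Real.exp h * 4 * (Real.log ((Real.cosh (gaussRate v - h / (2 * m)) + 1)
        / (Real.cosh (gaussRate v - h / (2 * m)) - 1)) / 2
      + 1 / ((2 * m - 1) * (Real.cosh (gaussRate v - h / (2 * m)) - 1))))
    / ((1 - Real.exp v ^ (-h)) * Real.Gamma (1 + h))

theorem ten_mul_sqrt_two_sub_pos : 0 < 10 * √2 - 14 := by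
  have : (1.4 : ℝ) < √2 := Real.lt_sqrt_of_sq_lt (by norm_num)
  linarith

/-- Lowering the rate by `η` costs `e^(2mη)` in convergence and, to leading order, a multiple of
`η^(-h)` in the comparison constant. The product is smallest at `η = h/(2m)`, whence this choice of
`L`; the convergence loss is then `e^h`. -/
theorem later_bound {h P T v : ℝ} {m : ℕ} (hh : 0 < h) (hP : 0 < P) (hT : 0 < T) (hv : 0 < v)
    (hm : 0 < m) (hL : 0 < gaussRate v - h / (2 * m)) :
    ((10 * √2 - 14) / Real.exp 1 * P * T⁻¹ * Real.exp v) ^ (-h) / (1 - Real.exp v ^ (-h))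
        * ((h / (Real.exp 1 * (((Real.exp v + 1) - (Real.exp v - 1)
            * Real.cosh (gaussRate v - h / (2 * m))) / 2))) ^ h
          / Real.Gamma (1 + h)
        * (4 * Real.exp (-(2 * m * (gaussRate v - h / (2 * m))))
          * (Real.log ((Real.cosh (gaussRate v - h / (2 * m)) + 1)
            / (Real.cosh (gaussRate v - h / (2 * m)) - 1)) / 2
          + 1 / ((2 * m - 1) * (Real.cosh (gaussRate v - h / (2 * m)) - 1)))))
      ≤ T ^ h * Real.exp (m * v - 2 * m * Real.log (3 + 2 * √2)) * laterConst h P v m := by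
  have hm1 : (1 : ℝ) ≤ m := by exact_mod_cast hm
  have hg := ten_mul_sqrt_two_sub_pos
  set A := gaussRate v with hA
  set L := A - h / (2 * m) with hLdef
  set q := Real.exp v with hq
  have hq1 : 1 < q := Real.one_lt_exp_iff.2 hv
  have hq0 : 0 < q - 1 := by linarith
  set J := Real.log ((Real.cosh L + 1) / (Real.cosh L - 1)) / 2
    + 1 / ((2 * m - 1) * (Real.cosh L - 1)) with hJ
  have hJ0 : 0 ≤ J := by
    have h1 : 1 < Real.cosh L := Real.one_lt_cosh.2 hL.ne'
    have h3 : 0 ≤ Real.log ((Real.cosh L + 1) / (Real.cosh L - 1)) :=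
      Real.log_nonneg ((one_le_div (by linarith)).2 (by linarith))
    have h4 : (0 : ℝ) ≤ 2 * m - 1 := by linarith
    have h5 : 0 ≤ Real.cosh L - 1 := by linarith
    rw [hJ]; positivity
  have hΓ : 0 < Real.Gamma (1 + h) := Real.Gamma_pos_of_pos (by linarith)
  have hqh : 0 < 1 - q ^ (-h) := by
    have := Real.rpow_lt_one_of_one_lt_of_neg hq1 (neg_neg_of_pos hh)
    linarith
  have hη : 0 < h / (2 * m) := by positivity
  have hsinh : 0 < Real.sinh (A - h / (4 * m)) := by
    refine Real.sinh_pos_iff.2 ?_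
    have : h / (4 * m) = h / (2 * m) / 2 := by field_simp; norm_num
    linarith
  set δ := ((q + 1) - (q - 1) * Real.cosh L) / 2 with hδ
  -- Since `(q - 1) cosh A = q + 1`, the quantity `δ` is `(q - 1)(cosh A - cosh L)/2`, with `A - L =
  -- h/(2m)`.
  have hδge : (q - 1) * h / (4 * m) * Real.sinh (A - h / (4 * m)) ≤ δ := by
    have h1 := cosh_sub_cosh_sub_ge hη.le (by linarith : h / (2 * m) ≤ A)
    have h2 : Real.cosh A * (q - 1) = q + 1 := by
      rw [hA, cosh_gaussRate hv, div_mul_cancel₀ _ hq0.ne']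
    have h3 : δ = (q - 1) * (Real.cosh A - Real.cosh L) / 2 := by rw [hδ, ← h2]; ring
    rw [h3]
    have h4 := mul_le_mul_of_nonneg_left h1 hq0.le
    have e : h / (2 * m) / 2 = h / (4 * m) := by field_simp; norm_num
    rw [e] at h4
    have e2 : (q - 1) * h / (4 * m) * Real.sinh (A - h / (4 * m))
        = (q - 1) * (h / (2 * m) * Real.sinh (A - h / (4 * m))) / 2 := by ring
    rw [e2]
    linarith
  have hδ'0 : 0 < (q - 1) * h / (4 * m) * Real.sinh (A - h / (4 * m)) := by positivity
  have hδ0 : 0 < δ := hδ'0.trans_le hδge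
  have hexp : Real.exp (-(2 * m * L))
      ≤ Real.exp h * Real.exp (m * v - 2 * m * Real.log (3 + 2 * √2)) := by
    have h1 := exp_neg_gaussRate_le hv
    have h2 := Real.exp_le_exp.1 h1
    rw [← Real.exp_add, Real.exp_le_exp, hLdef]
    have h3 : 2 * m * (h / (2 * m)) = h := by field_simp
    have h4 := mul_le_mul_of_nonneg_left h2 (by positivity : (0 : ℝ) ≤ 2 * m)
    rw [← hA] at h4
    nlinarith
  have hpow : ((10 * √2 - 14) / Real.exp 1 * P * T⁻¹ * q) ^ (-h) * (h / (Real.exp 1 * δ)) ^ h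
      ≤ T ^ h * (4 * (m / P) / ((10 * √2 - 14) * q * (q - 1)
        * Real.sinh (A - h / (4 * m)))) ^ h := by
    rw [Real.rpow_neg (by positivity), ← Real.inv_rpow (by positivity),
      ← Real.mul_rpow (by positivity) (by positivity),
      ← Real.mul_rpow hT.le (by positivity)]
    refine Real.rpow_le_rpow (by positivity) ?_ hh.le
    calc ((10 * √2 - 14) / Real.exp 1 * P * T⁻¹ * q)⁻¹ * (h / (Real.exp 1 * δ))
        ≤ ((10 * √2 - 14) / Real.exp 1 * P * T⁻¹ * q)⁻¹ * (h / (Real.exp 1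
          * ((q - 1) * h / (4 * m) * Real.sinh (A - h / (4 * m))))) := by gcongr
      _ = _ := by
          have : (10 * √2 - 14) ≠ 0 := hg.ne'
          generalize 10 * √2 - 14 = g at *
          generalize Real.sinh (A - h / (4 * m)) = σ at *
          field_simp
  calc _ = (((10 * √2 - 14) / Real.exp 1 * P * T⁻¹ * q) ^ (-h) * (h / (Real.exp 1 * δ)) ^ h)
        * Real.exp (-(2 * m * L)) * (4 * J / ((1 - q ^ (-h)) * Real.Gamma (1 + h))) := by
        field_simp
    _ ≤ (T ^ h * (4 * (m / P) / ((10 * √2 - 14) * q * (q - 1)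
        * Real.sinh (A - h / (4 * m)))) ^ h)
        * (Real.exp h * Real.exp (m * v - 2 * m * Real.log (3 + 2 * √2)))
        * (4 * J / ((1 - q ^ (-h)) * Real.Gamma (1 + h))) := by
        gcongr
    _ = _ := by
        unfold laterConst
        rw [← hA, ← hLdef, ← hq, ← hJ]
        ring

end RoughKernel

/-! ### Limits of the constants, rounding corrections and the first interval. -/

namespace RoughKernel

open Set

theorem log_add_div_sub_sqrt_two :
    Real.log ((√2 + 1) / (√2 - 1)) = Real.log (3 + 2 * √2) := by
  have h : (√2 + 1) / (√2 - 1) = 3 + 2 * √2 := by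
    rw [← inv_one_add_sqrt_two, div_inv_eq_mul]
    nlinarith [Real.sq_sqrt (show (0 : ℝ) ≤ 2 by norm_num)]
  rw [h]

/-- The exponent `v` such that consecutive partition points have the ratio `exp v`. -/
noncomputable def stepExponent (h κ P : ℝ) (n : ℕ) : ℝ :=
  (Real.log (3 + 2 * √2) * (P / h) - κ * Real.log P) / n

/-- The limit of the constants in the error bounds for the later intervals. -/
noncomputable def laterLimit (h : ℝ) : ℝ :=
  Real.exp h * (2 * Real.log (3 + 2 * √2))
    / ((1 - (3 + 2 * √2) ^ (-h)) * Real.Gamma (1 + h))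

section Limits

variable {P : ℕ → ℝ} {m n : ℕ → ℕ} {h : ℝ}

theorem tendsto_natCast_div_of_abs_sub_le {k : ℕ → ℕ} {R : ℕ → ℝ} (hR : Tendsto R atTop atTop)
    (hk : ∀ N, |(k N : ℝ) - R N| ≤ 1) : Tendsto (fun N => (k N : ℝ) / R N) atTop (𝓝 1) := by
  rw [← tendsto_sub_nhds_zero_iff]
  refine squeeze_zero_norm' ?_ hR.inv_tendsto_atTop
  filter_upwards [hR.eventually_gt_atTop 0] with N hN
  rw [Real.norm_eq_abs, Pi.inv_apply, div_sub_one hN.ne', abs_div, abs_of_pos hN, ← one_div]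
  exact div_le_div_of_nonneg_right (hk N) hN.le

theorem tendsto_natCast_atTop_of_abs_sub_le {k : ℕ → ℕ} {R : ℕ → ℝ} (hR : Tendsto R atTop atTop)
    (hk : ∀ N, |(k N : ℝ) - R N| ≤ 1) : Tendsto (fun N => (k N : ℝ)) atTop atTop := by
  refine tendsto_atTop_mono (fun N => ?_) (tendsto_atTop_add_const_right _ (-1) hR)
  linarith [(abs_le.1 (hk N)).1]

theorem tendsto_log_div_natCast (hP : Tendsto P atTop atTop) (hh : 0 < h)
    (hn : ∀ N, |(n N : ℝ) - P N / h| ≤ 1) :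
    Tendsto (fun N => Real.log (P N) / n N) atTop (𝓝 0) := by
  have hPh : Tendsto (fun N => P N / h) atTop atTop := hP.atTop_div_const hh
  have h1 : Tendsto (fun N => Real.log (P N) / P N) atTop (𝓝 0) :=
    (Real.isLittleO_log_id_atTop.tendsto_div_nhds_zero).comp hP
  have h2 := (tendsto_natCast_div_of_abs_sub_le hPh hn).inv₀ one_ne_zero
  have h3 := (h1.mul h2).mul_const h
  rw [zero_mul, zero_mul] at h3
  refine h3.congr' ?_
  filter_upwards [hP.eventually_gt_atTop 0] with N hN
  rw [inv_div]
  field_simp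

theorem tendsto_stepExponent (hP : Tendsto P atTop atTop) (hh : 0 < h) (κ : ℝ)
    (hn : ∀ N, |(n N : ℝ) - P N / h| ≤ 1) :
    Tendsto (fun N => stepExponent h κ (P N) (n N)) atTop (𝓝 (Real.log (3 + 2 * √2))) := by
  have hPh : Tendsto (fun N => P N / h) atTop atTop := hP.atTop_div_const hh
  have h2 := (tendsto_natCast_div_of_abs_sub_le hPh hn).inv₀ one_ne_zero
  have h3 := (h2.const_mul (Real.log (3 + 2 * √2))).sub
    ((tendsto_log_div_natCast hP hh hn).const_mul κ)
  rw [inv_one, mul_one, mul_zero, sub_zero] at h3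
  refine h3.congr fun N => ?_
  rw [stepExponent, inv_div]
  ring

theorem tendsto_laterConst {v : ℕ → ℝ} (hP : Tendsto P atTop atTop) (hh : 0 < h)
    (hm : ∀ N, |(m N : ℝ) - P N| ≤ 1)
    (hv : Tendsto v atTop (𝓝 (Real.log (3 + 2 * √2)))) :
    Tendsto (fun N => laterConst h (P N) (v N) (m N)) atTop (𝓝 (laterLimit h)) := by
  have hmT := tendsto_natCast_atTop_of_abs_sub_le hP hm
  have hmP := tendsto_natCast_div_of_abs_sub_le hP hm
  have hq : Tendsto (fun N => Real.exp (v N)) atTop (𝓝 (3 + 2 * √2)) := by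
    rw [← exp_log_three_add]
    exact (Real.continuous_exp.tendsto _).comp hv
  have hA : Tendsto (fun N => gaussRate (v N)) atTop (𝓝 (gaussRate (Real.log (3 + 2 * √2)))) :=
    (continuousAt_gaussRate log_three_add_pos).tendsto.comp hv
  have hη : ∀ c : ℝ, 0 < c → Tendsto (fun N => h / (c * m N)) atTop (𝓝 0) := fun c hc =>
    tendsto_const_nhds.div_atTop (hmT.const_mul_atTop hc)
  have hL := hA.sub (hη 2 two_pos)
  have hL4 := hA.sub (hη 4 four_pos)
  rw [sub_zero] at hL hL4
  have hcosh := (Real.continuous_cosh.tendsto _).comp hL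
  rw [cosh_gaussRate_log] at hcosh
  have hsinh := (Real.continuous_sinh.tendsto _).comp hL4
  rw [sinh_gaussRate_log] at hsinh
  have hs2 : (1.4 : ℝ) < √2 := Real.lt_sqrt_of_sq_lt (by norm_num)
  have hsq := Real.sq_sqrt (show (0 : ℝ) ≤ 2 by norm_num)
  have hΓ : 0 < Real.Gamma (1 + h) := Real.Gamma_pos_of_pos (by linarith)
  have hwh : (3 + 2 * √2) ^ (-h) < 1 :=
    Real.rpow_lt_one_of_one_lt_of_neg (by linarith) (neg_neg_of_pos hh)
  have hbase : Tendsto (fun N => 4 * (m N / P N) / ((10 * √2 - 14) * Real.exp (v N)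
      * (Real.exp (v N) - 1) * Real.sinh (gaussRate (v N) - h / (4 * m N)))) atTop (𝓝 1) := by
    -- At the limiting ratio `q = 3 + 2√2` the number `10√2 - 14` equals `4/(q(q-1))`. This choice
    -- in `a` makes the `h`-th power tend to `1`.
    have hden : (10 * √2 - 14) * (3 + 2 * √2) * (3 + 2 * √2 - 1) * 1 = 4 := by
      nlinarith
    have := (hmP.const_mul 4).div (((hq.const_mul (10 * √2 - 14)).mul (hq.sub_const 1)).mul hsinh)
      (by rw [hden]; norm_num)
    rw [hden, mul_one, div_self four_ne_zero] at this
    exact this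
  have h1 := hbase.rpow_const (p := h) (Or.inl one_ne_zero)
  rw [Real.one_rpow] at h1
  have hc1 : √2 - 1 ≠ 0 := by linarith
  have hlog : Tendsto (fun N => Real.log ((Real.cosh (gaussRate (v N) - h / (2 * m N)) + 1)
        / (Real.cosh (gaussRate (v N) - h / (2 * m N)) - 1)) / 2) atTop
      (𝓝 (Real.log (3 + 2 * √2) / 2)) := by
    rw [← log_add_div_sub_sqrt_two]
    refine Tendsto.div_const (Tendsto.log ?_ ?_) 2
    · exact (hcosh.add_const 1).div (hcosh.sub_const 1) hc1
    · exact (div_pos (by linarith) (by linarith)).ne'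
  have hrest : Tendsto (fun N => 1 / ((2 * (m N : ℝ) - 1)
      * (Real.cosh (gaussRate (v N) - h / (2 * m N)) - 1))) atTop (𝓝 0) := by
    refine tendsto_const_nhds.div_atTop ?_
    refine Tendsto.atTop_mul_pos (C := √2 - 1) (by linarith) ?_ (hcosh.sub_const 1)
    exact tendsto_atTop_add_const_right _ (-1) (hmT.const_mul_atTop two_pos)
  have hqh : Tendsto (fun N => (1 - Real.exp (v N) ^ (-h)) * Real.Gamma (1 + h)) atTop
      (𝓝 ((1 - (3 + 2 * √2) ^ (-h)) * Real.Gamma (1 + h))) :=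
    ((hq.rpow_const (Or.inl (by positivity))).const_sub 1).mul_const _
  have := (h1.mul (((hlog.add hrest).const_mul (Real.exp h * 4)))).div hqh
    (mul_pos (by linarith) hΓ).ne'
  have e : laterLimit h = 1 * (Real.exp h * 4 * (Real.log (3 + 2 * √2) / 2 + 0))
      / ((1 - (3 + 2 * √2) ^ (-h)) * Real.Gamma (1 + h)) := by
    rw [laterLimit]; ring
  rw [e]
  exact this

/-- The convergence rate of the later intervals, up to a factor that tends to `1`. -/
theorem exp_later_eq {κ p : ℝ} {k l : ℕ} (hh : 0 < h) (hp : 0 < p) (hl : 0 < l) :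
    Real.exp (k * stepExponent h κ p l - 2 * k * Real.log (3 + 2 * √2))
      = Real.exp (-(Real.log (3 + 2 * √2) * p)) * p ^ (-(κ * h))
        * Real.exp (Real.log (3 + 2 * √2) * ((p - k) + h * (p / h - l)))
        * Real.exp (κ * (Real.log p * (h - k / l))
          + Real.log (3 + 2 * √2) * ((k / l - h) * (p / h - l))) := by
  have hl' : (l : ℝ) ≠ 0 := by positivity
  rw [Real.rpow_def_of_pos hp, ← Real.exp_add, ← Real.exp_add, ← Real.exp_add, stepExponent]
  congr 1
  field_simp
  ring

/-- The difference is `(h (l - p/h) - (k - p))/l`, two rounding errors divided by `l`. -/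
theorem abs_sub_div_le {p : ℝ} {k l : ℕ} (hh : 0 < h) (hh1 : h < 1) (hl : 0 < l)
    (hk : |(k : ℝ) - p| ≤ 1) (hlp : |(l : ℝ) - p / h| ≤ 1) : |h - (k : ℝ) / l| ≤ 2 / l := by
  have hl' : (0 : ℝ) < l := by exact_mod_cast hl
  have e : h - (k : ℝ) / l = (h * (l - p / h) - (k - p)) / l := by field_simp; ring
  rw [e, abs_div, abs_of_pos hl']
  gcongr
  refine (abs_sub _ _).trans ?_
  rw [abs_mul, abs_of_pos hh]
  nlinarith [abs_nonneg ((l : ℝ) - p / h)]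

/-- The discrepancy `h - m/n` is `O(1/n)`, small enough to absorb the factor `log P` as well as the
bounded rounding error of `n`. -/
theorem tendsto_later_correction (hP : Tendsto P atTop atTop) (hh : 0 < h) (hh1 : h < 1) (κ : ℝ)
    (hm : ∀ N, |(m N : ℝ) - P N| ≤ 1) (hn : ∀ N, |(n N : ℝ) - P N / h| ≤ 1)
    (hn0 : ∀ N, 0 < n N) :
    Tendsto (fun N => Real.exp (κ * (Real.log (P N) * (h - m N / n N))
      + Real.log (3 + 2 * √2) * ((m N / n N - h) * (P N / h - n N)))) atTop (𝓝 1) := by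
  have hPh : Tendsto (fun N => P N / h) atTop atTop := hP.atTop_div_const hh
  have hnT := tendsto_natCast_atTop_of_abs_sub_le hPh hn
  have h1 : Tendsto (fun N => Real.log (P N) * (h - m N / n N)) atTop (𝓝 0) := by
    have hz := (tendsto_log_div_natCast hP hh hn).const_mul 2
    rw [mul_zero] at hz
    refine squeeze_zero_norm' ?_ hz
    filter_upwards [hP.eventually_ge_atTop 1] with N hN
    rw [norm_mul, Real.norm_eq_abs, Real.norm_eq_abs, abs_of_nonneg (Real.log_nonneg hN)]
    calc _ ≤ Real.log (P N) * (2 / n N) := mul_le_mul_of_nonneg_left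
          (abs_sub_div_le hh hh1 (hn0 N) (hm N) (hn N)) (Real.log_nonneg hN)
      _ = _ := by ring
  have h2 : Tendsto (fun N => (m N / n N - h) * (P N / h - n N)) atTop (𝓝 0) := by
    refine squeeze_zero_norm (fun N => ?_) (tendsto_const_nhds.div_atTop hnT : Tendsto
      (fun N => (2 : ℝ) / n N) atTop (𝓝 0))
    rw [norm_mul, Real.norm_eq_abs, Real.norm_eq_abs, abs_sub_comm _ h, abs_sub_comm (P N / h)]
    calc _ ≤ 2 / (n N : ℝ) * 1 := mul_le_mul (abs_sub_div_le hh hh1 (hn0 N) (hm N) (hn N))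
          (hn N) (abs_nonneg _) (by positivity)
      _ = _ := mul_one _
  have := (h1.const_mul κ).add (h2.const_mul (Real.log (3 + 2 * √2)))
  simp only [mul_zero, add_zero] at this
  have h3 := (Real.continuous_exp.tendsto _).comp this
  rw [Real.exp_zero] at h3
  exact h3

end Limits

/-- The normalized error on the first interval. -/
noncomputable def firstConst (h P T v : ℝ) (m : ℕ) : ℝ :=
  2 * (3 + 2 * √2) * (9 / 16) ^ m * P
    * ((10 * √2 - 14) / Real.exp 1 * T⁻¹ * Real.exp v) ^ (1 - h) / (1 - h) * T * T ^ (-h)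

theorem pow_div_factorial_le {x : ℝ} (hx : 0 ≤ x) {k : ℕ} (hk : 0 < k) :
    x ^ k / k.factorial ≤ (x * Real.exp 1 / k) ^ k := by
  have h1 := Real.pow_div_factorial_le_exp (k : ℝ) (by positivity) k
  have hk' : (0 : ℝ) < k := by exact_mod_cast hk
  rw [div_pow, mul_pow, ← Real.exp_nat_mul, mul_one]
  rw [div_le_iff₀ (by positivity)] at h1 ⊢
  rw [div_mul_eq_mul_div, le_div_iff₀ (by positivity), mul_assoc]
  exact mul_le_mul_of_nonneg_left h1 (by positivity)

/-- By `k^k/k! ≤ e^k` the Taylor error is the `2m`-th power of the left side of `hbase`. The factor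
`3/4` there yields `(9/16)^m` beyond the target rate, while replacing `m` by `P` costs at most `3 +
2√2`. -/
theorem first_bound {h P T v c : ℝ} {m : ℕ} (hh1 : h < 1) (hP : 0 < P) (hT : 0 < T)
    (hm : 0 < m) (hmP : P - m ≤ 1) (hc : 0 ≤ c)
    (hbase : (10 * √2 - 14) * Real.exp v * (P / m) / 4 ≤ (√2 - 1) * (3 / 4)) :
    2 * (((10 * √2 - 14) / Real.exp 1 * P * T⁻¹ * Real.exp v * T / 2) ^ (2 * m)
        / (2 * m).factorial)
      * (c * (((10 * √2 - 14) / Real.exp 1 * P * T⁻¹ * Real.exp v) ^ (1 - h) / (1 - h))) * T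
      ≤ c * T ^ h * Real.exp (-(Real.log (3 + 2 * √2) * P)) * P ^ (-h) * firstConst h P T v m := by
  have hg := ten_mul_sqrt_two_sub_pos
  have hm' : (0 : ℝ) < m := by exact_mod_cast hm
  have hfac : ((10 * √2 - 14) / Real.exp 1 * P * T⁻¹ * Real.exp v * T / 2) ^ (2 * m)
        / (2 * m).factorial
      ≤ Real.exp (-(Real.log (3 + 2 * √2) * P)) * ((3 + 2 * √2) * (9 / 16) ^ m) := by
    refine (pow_div_factorial_le (by positivity) (by omega)).trans ?_
    have e1 : (10 * √2 - 14) / Real.exp 1 * P * T⁻¹ * Real.exp v * T / 2 * Real.exp 1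
        / ((2 * m : ℕ) : ℝ) = (10 * √2 - 14) * Real.exp v * (P / m) / 4 := by
      push_cast
      generalize 10 * √2 - 14 = g at *
      field_simp
      norm_num
    rw [e1]
    have e2 : ((√2 - 1) * (3 / 4)) ^ (2 * m)
        = Real.exp (-(Real.log (3 + 2 * √2) * m)) * (9 / 16) ^ m := by
      rw [← inv_one_add_sqrt_two, ← exp_half_log_three_add, ← Real.exp_neg, mul_pow, pow_mul,
        pow_mul (3 / 4 : ℝ), ← Real.exp_nat_mul, ← Real.exp_nat_mul]
      congr 2
      · push_cast; ring
      · norm_num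
    calc _ ≤ ((√2 - 1) * (3 / 4)) ^ (2 * m) := by gcongr
      _ = Real.exp (-(Real.log (3 + 2 * √2) * m)) * (9 / 16) ^ m := e2
      _ ≤ (Real.exp (-(Real.log (3 + 2 * √2) * P)) * (3 + 2 * √2)) * (9 / 16) ^ m := by
          gcongr
          rw [← exp_log_three_add, ← Real.exp_add, Real.exp_le_exp, exp_log_three_add]
          nlinarith [log_three_add_pos]
      _ = _ := by ring
  have hpow : ((10 * √2 - 14) / Real.exp 1 * P * T⁻¹ * Real.exp v) ^ (1 - h)
      = P ^ (-h) * P * ((10 * √2 - 14) / Real.exp 1 * T⁻¹ * Real.exp v) ^ (1 - h) := by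
    rw [show (10 * √2 - 14) / Real.exp 1 * P * T⁻¹ * Real.exp v
      = P * ((10 * √2 - 14) / Real.exp 1 * T⁻¹ * Real.exp v) by ring,
      Real.mul_rpow hP.le (by positivity), show 1 - h = -h + 1 by ring, Real.rpow_add_one hP.ne']
  have hTh : T ^ h * T ^ (-h) = 1 := by rw [← Real.rpow_add hT]; simp
  have h1h : 0 < 1 - h := by linarith
  calc _ ≤ 2 * (Real.exp (-(Real.log (3 + 2 * √2) * P)) * ((3 + 2 * √2) * (9 / 16) ^ m))
      * (c * (((10 * √2 - 14) / Real.exp 1 * P * T⁻¹ * Real.exp v) ^ (1 - h) / (1 - h))) * T := by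
        gcongr
    _ = (T ^ h * T ^ (-h)) * (2 * (Real.exp (-(Real.log (3 + 2 * √2) * P))
      * ((3 + 2 * √2) * (9 / 16) ^ m))
      * (c * (((10 * √2 - 14) / Real.exp 1 * P * T⁻¹ * Real.exp v) ^ (1 - h) / (1 - h))) * T) := by
        rw [hTh, one_mul]
    _ = _ := by
        rw [hpow, firstConst]
        ring

theorem tendsto_firstConst {P v : ℕ → ℝ} {m : ℕ → ℕ} {h T : ℝ} (hP : Tendsto P atTop atTop)
    (hT : 0 < T) (hm : ∀ N, |(m N : ℝ) - P N| ≤ 1)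
    (hv : Tendsto v atTop (𝓝 (Real.log (3 + 2 * √2)))) :
    Tendsto (fun N => firstConst h (P N) T (v N) (m N)) atTop (𝓝 0) := by
  have hg := ten_mul_sqrt_two_sub_pos
  have hmT := tendsto_natCast_atTop_of_abs_sub_le hP hm
  have hmN : Tendsto m atTop atTop := tendsto_natCast_atTop_iff.1 hmT
  have hq : Tendsto (fun N => Real.exp (v N)) atTop (𝓝 (Real.exp (Real.log (3 + 2 * √2)))) :=
    (Real.continuous_exp.tendsto _).comp hv
  have h1 : Tendsto (fun N => (9 / 16 : ℝ) ^ m N * P N) atTop (𝓝 0) := by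
    have h2 : Tendsto (fun k : ℕ => (k : ℝ) * (9 / 16 : ℝ) ^ k) atTop (𝓝 0) :=
      tendsto_self_mul_const_pow_of_lt_one (by norm_num) (by norm_num)
    have h3 : Tendsto (fun k : ℕ => (9 / 16 : ℝ) ^ k) atTop (𝓝 0) :=
      tendsto_pow_atTop_nhds_zero_of_lt_one (by norm_num) (by norm_num)
    have h4 := (h2.add h3).comp hmN
    rw [add_zero] at h4
    refine squeeze_zero' ?_ ?_ h4
    · filter_upwards [hP.eventually_ge_atTop 0] with N hN
      positivity
    · refine Eventually.of_forall fun N => ?_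
      have := (abs_le.1 (hm N)).1
      have h5 : (0 : ℝ) < (9 / 16) ^ m N := by positivity
      simp only [Function.comp_apply]
      nlinarith
  have h2 : Tendsto (fun N => ((10 * √2 - 14) / Real.exp 1 * T⁻¹ * Real.exp (v N)) ^ (1 - h))
      atTop (𝓝 (((10 * √2 - 14) / Real.exp 1 * T⁻¹
        * Real.exp (Real.log (3 + 2 * √2))) ^ (1 - h))) :=
    (hq.const_mul _).rpow_const (Or.inl (by positivity))
  have h3 := ((h1.mul h2).const_mul (2 * (3 + 2 * √2))).mul_const (1 / (1 - h) * T * T ^ (-h))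
  simp only [zero_mul, mul_zero] at h3
  refine h3.congr fun N => ?_
  unfold firstConst
  ring

end RoughKernel

/-! ### Numerical estimate of the constant in the balanced case. -/

namespace RoughKernel

open Set

/-- Log-convexity of `Γ` at `1`, between `1/2` and `1 + h`, with `Γ(1/2) = √π`. This bound is sharp
as `h → 0`. -/
theorem pi_rpow_neg_le_Gamma {h : ℝ} (hh : 0 < h) : Real.pi ^ (-h) ≤ Real.Gamma (1 + h) := by
  have hΓ : 0 < Real.Gamma (1 + h) := Real.Gamma_pos_of_pos (by linarith)
  have hc := Real.convexOn_log_Gamma.2 (show (1 / 2 : ℝ) ∈ Ioi 0 by norm_num)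
    (show 1 + h ∈ Ioi 0 by simp only [mem_Ioi]; linarith)
    (show 0 ≤ 2 * h / (1 + 2 * h) by positivity) (show 0 ≤ 1 / (1 + 2 * h) by positivity)
    (by field_simp; ring)
  have e : 2 * h / (1 + 2 * h) * (1 / 2) + 1 / (1 + 2 * h) * (1 + h) = 1 := by field_simp; ring
  simp only [smul_eq_mul, Function.comp_apply, e, Real.Gamma_one, Real.log_one,
    Real.Gamma_one_half_eq] at hc
  rw [Real.log_sqrt Real.pi_pos.le] at hc
  have h1 : 0 ≤ h * Real.log Real.pi + Real.log (Real.Gamma (1 + h)) := by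
    have h2 : 2 * h / (1 + 2 * h) * (Real.log Real.pi / 2)
        + 1 / (1 + 2 * h) * Real.log (Real.Gamma (1 + h))
        = (h * Real.log Real.pi + Real.log (Real.Gamma (1 + h))) / (1 + 2 * h) := by
      field_simp
    rw [h2] at hc
    simpa using (le_div_iff₀ (by linarith)).1 hc
  rw [Real.rpow_def_of_pos Real.pi_pos, ← Real.le_log_iff_exp_le hΓ]
  linarith

/-- Log-convexity of `Γ` at `2`, between `1 + h` and `3`. This bound is sharp as `h → 1`. -/
theorem two_rpow_le_Gamma {h : ℝ} (hh : 0 < h) (hh1 : h < 1) :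
    (2 : ℝ) ^ (-(1 - h)) ≤ Real.Gamma (1 + h) := by
  have hΓ : 0 < Real.Gamma (1 + h) := Real.Gamma_pos_of_pos (by linarith)
  have h2h : 0 < 2 - h := by linarith
  have hc := Real.convexOn_log_Gamma.2 (show 1 + h ∈ Ioi 0 by simp only [mem_Ioi]; linarith)
    (show (3 : ℝ) ∈ Ioi 0 by norm_num) (show 0 ≤ 1 / (2 - h) by positivity)
    (show 0 ≤ (1 - h) / (2 - h) from div_nonneg (by linarith) h2h.le) (by field_simp; ring)
  have e : 1 / (2 - h) * (1 + h) + (1 - h) / (2 - h) * 3 = 2 := by field_simp; ring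
  have e3 : Real.Gamma 3 = 2 := by
    rw [show (3 : ℝ) = 2 + 1 by norm_num, Real.Gamma_add_one two_ne_zero, Real.Gamma_two, mul_one]
  simp only [smul_eq_mul, Function.comp_apply, e, Real.Gamma_two, Real.log_one, e3] at hc
  have h1 : 0 ≤ Real.log (Real.Gamma (1 + h)) + (1 - h) * Real.log 2 := by
    have h2 : 1 / (2 - h) * Real.log (Real.Gamma (1 + h)) + (1 - h) / (2 - h) * Real.log 2
        = (Real.log (Real.Gamma (1 + h)) + (1 - h) * Real.log 2) / (2 - h) := by
      field_simp
    rw [h2] at hc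
    simpa using (le_div_iff₀ h2h).1 hc
  rw [Real.rpow_def_of_pos two_pos, ← Real.le_log_iff_exp_le hΓ]
  linarith

/-- A rational `y` just above the `k`-th root of `A` turns a bound on a real power, for `h ≤ p/k`,
into integer-power arithmetic. -/
theorem rpow_le_pow_of_le {A y h : ℝ} {k p : ℕ} (hA : 0 ≤ A) (hy : 1 ≤ y) (hAy : A ≤ y ^ k)
    (hh : 0 ≤ h) (hk : k * h ≤ p) : A ^ h ≤ y ^ p := by
  calc A ^ h ≤ (y ^ k) ^ h := Real.rpow_le_rpow hA hAy hh
    _ = y ^ (k * h) := by rw [← Real.rpow_natCast, ← Real.rpow_mul (by linarith)]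
    _ ≤ y ^ (p : ℝ) := Real.rpow_le_rpow_of_exponent_le hy hk
    _ = y ^ p := Real.rpow_natCast y p

/-- The factor arises from `P^(-h/2) = h^(-h/4) N^(-h/4)`. As `-h log h ≤ 1/e`, it is at most `exp
(1/(4e))`. -/
theorem rpow_neg_self_div_four_le {h : ℝ} (hh : 0 < h) : h ^ (-h / 4) ≤ 1.102 := by
  have h1 : -(h * Real.log h) ≤ 1 / Real.exp 1 := by
    have h2 := Real.log_le_sub_one_of_pos (show 0 < 1 / (h * Real.exp 1) by positivity)
    rw [one_div, Real.log_inv, Real.log_mul hh.ne' (Real.exp_pos 1).ne', Real.log_exp] at h2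
    have h3 := mul_le_mul_of_nonneg_left h2 hh.le
    have h4 : h * ((h * Real.exp 1)⁻¹ - 1) = 1 / Real.exp 1 - h := by field_simp
    rw [h4] at h3
    linarith
  have h2 : 1 / Real.exp 1 ≤ 0.37 := by
    rw [div_le_iff₀ (Real.exp_pos 1)]
    linarith [Real.exp_one_gt_d9]
  rw [Real.rpow_def_of_pos hh]
  have h3 : Real.log h * (-h / 4) ≤ 0.0925 := by linarith
  have h4 := Real.add_one_le_exp (-0.0925 : ℝ)
  calc Real.exp (Real.log h * (-h / 4)) ≤ Real.exp 0.0925 := Real.exp_le_exp.2 h3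
    _ = (Real.exp (-0.0925))⁻¹ := by rw [Real.exp_neg, inv_inv]
    _ ≤ (-0.0925 + 1)⁻¹ := inv_anti₀ (by norm_num) h4
    _ ≤ 1.102 := by norm_num

theorem log_three_add_le : Real.log (3 + 2 * √2) ≤ 1.8 := by
  have hs : √2 ≤ 1.415 := Real.sqrt_le_iff.2 (by norm_num)
  have h1 : (3 + 2 * √2) ^ 5 ≤ Real.exp 1 ^ 9 := by
    calc (3 + 2 * √2) ^ 5 ≤ (5.83 : ℝ) ^ 5 := by gcongr; linarith
      _ ≤ 2.7 ^ 9 := by norm_num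
      _ ≤ Real.exp 1 ^ 9 := by gcongr; linarith [Real.exp_one_gt_d9]
  have h2 := Real.log_le_log (by positivity) h1
  rw [Real.log_pow, Real.log_pow, Real.log_exp] at h2
  push_cast at h2
  linarith

/-- The estimate `1 - e^(-αh) ≥ αh/(1 + αh)` cancels both the singularity at `h = 0` and the factor
`α` in the numerator. -/
theorem mul_laterLimit_le {h γ : ℝ} (hh : 0 < h) (hγ : 1 / Real.Gamma (1 + h) ≤ γ) :
    h * laterLimit h ≤ 2 * (1 + 1.8 * h) * (Real.exp 1 ^ h * γ) := by
  have hα := log_three_add_pos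
  have hα' := log_three_add_le
  have hΓ : 0 < Real.Gamma (1 + h) := Real.Gamma_pos_of_pos (by linarith)
  have hw : (3 + 2 * √2) ^ (-h) ≤ 1 / (1 + Real.log (3 + 2 * √2) * h) := by
    rw [Real.rpow_neg (by positivity), Real.rpow_def_of_pos (by positivity), ← one_div]
    refine one_div_le_one_div_of_le (by positivity) ?_
    linarith [Real.add_one_le_exp (Real.log (3 + 2 * √2) * h)]
  unfold laterLimit
  rw [← Real.exp_one_rpow h]
  generalize Real.log (3 + 2 * √2) = α at *
  have h1 : α * h / (1 + α * h) ≤ 1 - (3 + 2 * √2) ^ (-h) := by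
    have : α * h / (1 + α * h) = 1 - 1 / (1 + α * h) := by field_simp; ring
    linarith
  have h2 : 0 < α * h / (1 + α * h) := by positivity
  calc h * (Real.exp 1 ^ h * (2 * α) / ((1 - (3 + 2 * √2) ^ (-h)) * Real.Gamma (1 + h)))
      = 2 * α * h * (1 / (1 - (3 + 2 * √2) ^ (-h))) * (Real.exp 1 ^ h
        * (1 / Real.Gamma (1 + h))) := by rw [div_eq_mul_inv, mul_inv]; ring
    _ ≤ 2 * α * h * (1 / (α * h / (1 + α * h))) * (Real.exp 1 ^ h * γ) := by gcongr
    _ = 2 * (1 + α * h) * (Real.exp 1 ^ h * γ) := by field_simp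
    _ ≤ 2 * (1 + 1.8 * h) * (Real.exp 1 ^ h * γ) := by
        have : 0 ≤ γ := le_trans (by positivity) hγ
        gcongr

theorem constant_le_of_bounds {h γ a b k : ℝ} (hh : 0 < h) (hγ : 1 / Real.Gamma (1 + h) ≤ γ)
    (ha : (19.13 : ℝ) ^ h ≤ a) (hb : Real.exp 1 ^ h * γ ≤ b)
    (hk : 1.102 * (a + 2 * (1 + 1.8 * h) * b) ≤ k * h) :
    h ^ (-h / 4) * ((Real.exp 1 / (10 * √2 - 14)) ^ h / h + laterLimit h) ≤ k := by
  have hc : Real.exp 1 / (10 * √2 - 14) ≤ 19.13 := by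
    have hs : (1.41421 : ℝ) < √2 := Real.lt_sqrt_of_sq_lt (by norm_num)
    rw [div_le_iff₀ (by linarith)]
    linarith [Real.exp_one_lt_d9]
  have hc0 : 0 ≤ Real.exp 1 / (10 * √2 - 14) :=
    div_nonneg (Real.exp_pos 1).le ten_mul_sqrt_two_sub_pos.le
  have h1 := mul_laterLimit_le hh hγ
  have h2 : (Real.exp 1 / (10 * √2 - 14)) ^ h ≤ a := (Real.rpow_le_rpow hc0 hc hh.le).trans ha
  have h3 : h * laterLimit h ≤ 2 * (1 + 1.8 * h) * b := h1.trans (by gcongr)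
  have h4 : (Real.exp 1 / (10 * √2 - 14)) ^ h / h + laterLimit h
      = ((Real.exp 1 / (10 * √2 - 14)) ^ h + h * laterLimit h) / h := by field_simp
  have h5 : 0 ≤ a := le_trans (by positivity) h2
  have h6 : 0 ≤ Real.exp 1 ^ h * γ := mul_nonneg (by positivity)
    (le_trans (by have := Real.Gamma_pos_of_pos (show 0 < 1 + h by linarith); positivity) hγ)
  have h7 : 0 ≤ b := h6.trans hb
  rw [h4]
  calc _ ≤ 1.102 * ((a + 2 * (1 + 1.8 * h) * b) / h) := by
        refine mul_le_mul (rpow_neg_self_div_four_le hh) ?_ ?_ (by norm_num)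
        · gcongr
        · refine div_nonneg (add_nonneg (by positivity) ?_) hh.le
          have hw : (3 + 2 * √2) ^ (-h) < 1 := Real.rpow_lt_one_of_one_lt_of_neg
            (by linarith [Real.sqrt_nonneg 2]) (neg_neg_of_pos hh)
          have hΓ : 0 < Real.Gamma (1 + h) := Real.Gamma_pos_of_pos (by linarith)
          have hα := log_three_add_pos
          unfold laterLimit
          refine mul_nonneg hh.le (div_nonneg (by positivity) (mul_nonneg (by linarith) hΓ.le))
    _ ≤ k := by
        rw [← mul_div_assoc, div_le_iff₀ hh]
        exact hk

theorem constant_le {h : ℝ} (hh : 0 < h) (hh1 : h < 1) :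
    h ^ (-h / 4) * ((Real.exp 1 / (10 * √2 - 14)) ^ h / h + laterLimit h)
      ≤ max (200 / 3) (5 / h) := by
  have he := Real.exp_one_lt_d9
  have hγ1 : 1 / Real.Gamma (1 + h) ≤ Real.pi ^ h := by
    have := pi_rpow_neg_le_Gamma hh
    rw [Real.rpow_neg Real.pi_pos.le] at this
    rw [one_div]
    exact inv_le_of_inv_le₀ (by positivity) this
  have hγ2 : 1 / Real.Gamma (1 + h) ≤ (2 : ℝ) ^ (1 - h) := by
    have := two_rpow_le_Gamma hh hh1
    rw [Real.rpow_neg two_pos.le] at this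
    rw [one_div]
    exact inv_le_of_inv_le₀ (by positivity) this
  have hπe : Real.exp 1 ^ h * Real.pi ^ h ≤ (8.54 : ℝ) ^ h := by
    rw [← Real.mul_rpow (Real.exp_pos 1).le Real.pi_pos.le]
    refine Real.rpow_le_rpow (by positivity) ?_ hh.le
    nlinarith [Real.pi_lt_d4, Real.pi_pos, Real.exp_pos 1]
  -- On each subinterval of `h` the powers are replaced by constants, so the remaining condition is
  -- linear in `h`. Up to `2/5` the Gamma bound with `π` is used, beyond it the one with `2`. The
  -- bound `5/h` is needed only for small `h`; above `1/9` the constant `200/3` is enough.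
  rcases le_or_gt h (1 / 9) with h9 | h9
  · refine le_max_of_le_right (constant_le_of_bounds hh hγ1
      (rpow_le_pow_of_le (y := 1.39) (k := 9) (p := 1) (by norm_num) (by norm_num) (by norm_num)
        hh.le (by push_cast; linarith))
      (hπe.trans (rpow_le_pow_of_le (y := 1.27) (k := 9) (p := 1) (by norm_num) (by norm_num)
        (by norm_num) hh.le (by push_cast; linarith))) ?_)
    rw [div_mul_cancel₀ _ hh.ne']
    linarith
  refine le_max_of_le_left ?_
  rcases le_or_gt h (1 / 5) with h5 | h5
  · refine constant_le_of_bounds hh hγ1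
      (rpow_le_pow_of_le (y := 1.81) (k := 5) (p := 1) (by norm_num) (by norm_num) (by norm_num)
        hh.le (by push_cast; linarith))
      (hπe.trans (rpow_le_pow_of_le (y := 1.54) (k := 5) (p := 1) (by norm_num) (by norm_num)
        (by norm_num) hh.le (by push_cast; linarith))) ?_
    linarith
  rcases le_or_gt h (2 / 5) with h25 | h25
  · refine constant_le_of_bounds hh hγ1
      (rpow_le_pow_of_le (y := 1.81) (k := 5) (p := 2) (by norm_num) (by norm_num) (by norm_num)
        hh.le (by push_cast; linarith))
      (hπe.trans (rpow_le_pow_of_le (y := 1.54) (k := 5) (p := 2) (by norm_num) (by norm_num)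
        (by norm_num) hh.le (by push_cast; linarith))) ?_
    linarith
  rcases le_or_gt h (7 / 10) with h7 | h7
  · refine constant_le_of_bounds hh hγ2
      (rpow_le_pow_of_le (y := 1.3435) (k := 10) (p := 7) (by norm_num) (by norm_num)
        (by norm_num) hh.le (by push_cast; linarith))
      (mul_le_mul (rpow_le_pow_of_le (y := 1.1053) (k := 10) (p := 7) (by positivity)
          (by norm_num) (he.le.trans (by norm_num)) hh.le (by push_cast; linarith))
        (rpow_le_pow_of_le (y := 1.149) (k := 5) (p := 3) (by norm_num) (by norm_num)
          (by norm_num) (by linarith) (by push_cast; linarith)) (by positivity) (by positivity)) ?_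
    linarith
  · refine constant_le_of_bounds hh hγ2
      (rpow_le_pow_of_le (y := 19.13) (k := 1) (p := 1) (by norm_num) (by norm_num)
        (by norm_num) hh.le (by push_cast; linarith))
      (mul_le_mul (rpow_le_pow_of_le (y := 2.7183) (k := 1) (p := 1) (by positivity)
          (by norm_num) (he.le.trans (by norm_num)) hh.le (by push_cast; linarith))
        (rpow_le_pow_of_le (y := 1.072) (k := 10) (p := 3) (by norm_num) (by norm_num)
          (by norm_num) (by linarith) (by push_cast; linarith)) (by positivity) (by positivity)) ?_
    linarith

end RoughKernel

/-! ### The asymptotic error bound for both choices of the cutoff. -/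

namespace RoughKernel

open Set

/-- Both parts of the theorem are instances: `κ = 1` and `κ = 1/2`. The three summands come from the
tail, the later intervals and the first interval; `D` and `R` do not depend on the quadrature rule.
-/
theorem exists_eventually_l1Error_le {H T κ : ℝ} (hH : -(1 / 2) < H) (hH' : H < 1 / 2)
    (hT : 0 < T) :
    ∃ D R : ℕ → ℝ, Tendsto D atTop (𝓝 (laterLimit (H + 1 / 2))) ∧ Tendsto R atTop (𝓝 0) ∧
      (∀ᶠ N in atTop, 0 ≤ D N) ∧
      ∀ᶠ N : ℕ in atTop, ∀ a b : ℝ,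
        a = (10 * √2 - 14) / Real.exp 1 * √((H + 1 / 2) * N) * T⁻¹ →
        b = (10 * √2 - 14) / Real.exp 1 * √((H + 1 / 2) * N) ^ (1 - κ) * T⁻¹ →
        ∀ Q : GeometricGaussianRule H N (Real.log (3 + 2 * √2)) 1 a b,
        Q.l1Error T ≤ cH H * T ^ (H + 1 / 2)
          * Real.exp (-(Real.log (3 + 2 * √2) * √((H + 1 / 2) * N)))
          * ((Real.exp 1 / (10 * √2 - 14)) ^ (H + 1 / 2) / (H + 1 / 2)
              * √((H + 1 / 2) * N) ^ (-((1 - κ) * (H + 1 / 2)))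
            + √((H + 1 / 2) * N) ^ (-(κ * (H + 1 / 2)))
              * Real.exp (Real.log (3 + 2 * √2)
                * ((√((H + 1 / 2) * N) - rd (√((H + 1 / 2) * N)))
                  + (H + 1 / 2) * (√(N / (H + 1 / 2)) - rd (√(N / (H + 1 / 2)))))) * D N
            + √((H + 1 / 2) * N) ^ (-(H + 1 / 2)) * R N) := by
  set h := H + 1 / 2 with hhdef
  have hh : 0 < h := by linarith
  have hh1 : h < 1 := by linarith
  set P : ℕ → ℝ := fun N => √(h * N) with hPdef
  set m : ℕ → ℕ := fun N => rd (P N) with hmdef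
  set n : ℕ → ℕ := fun N => rd (√(N / h)) with hndef
  have hPh : ∀ N : ℕ, √(N / h) = P N / h := by
    intro N
    rw [show (N : ℝ) / h = (h * N) / h ^ 2 by field_simp, Real.sqrt_div (by positivity),
      Real.sqrt_sq hh.le]
  have hP : Tendsto P atTop atTop :=
    Real.tendsto_sqrt_atTop.comp (tendsto_natCast_atTop_atTop.const_mul_atTop hh)
  have hm : ∀ N, |(m N : ℝ) - P N| ≤ 1 := fun N => abs_rd_sub_le (Real.sqrt_nonneg _)
  have hn : ∀ N, |(n N : ℝ) - P N / h| ≤ 1 := fun N => by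
    rw [← hPh]; exact abs_rd_sub_le (Real.sqrt_nonneg _)
  have hm0 : ∀ N, 0 < m N := fun N => rd_pos _
  have hn0 : ∀ N, 0 < n N := fun N => rd_pos _
  set v : ℕ → ℝ := fun N => stepExponent h κ (P N) (n N) with hvdef
  have hv : Tendsto v atTop (𝓝 (Real.log (3 + 2 * √2))) := tendsto_stepExponent hP hh κ hn
  have hv0 : ∀ᶠ N in atTop, 0 < v N := hv.eventually_const_lt log_three_add_pos
  have hmT := tendsto_natCast_atTop_of_abs_sub_le hP hm
  have hη : Tendsto (fun N => h / (2 * (m N : ℝ))) atTop (𝓝 0) :=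
    tendsto_const_nhds.div_atTop (hmT.const_mul_atTop two_pos)
  have hL : ∀ᶠ N in atTop, 0 < gaussRate (v N) - h / (2 * m N) := by
    have h1 := ((continuousAt_gaussRate log_three_add_pos).tendsto.comp hv).sub hη
    rw [sub_zero] at h1
    exact h1.eventually_const_lt gaussRate_log_pos
  have hbase : ∀ᶠ N in atTop,
      (10 * √2 - 14) * Real.exp (v N) * (P N / m N) / 4 ≤ (√2 - 1) * (3 / 4) := by
    have h1 := (Real.continuous_exp.tendsto _).comp hv
    rw [exp_log_three_add] at h1
    have h2 := (tendsto_natCast_div_of_abs_sub_le hP hm).inv₀ one_ne_zero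
    have h3 := ((h1.const_mul (10 * √2 - 14)).mul h2).div_const 4
    have hs : (1.4 : ℝ) < √2 := Real.lt_sqrt_of_sq_lt (by norm_num)
    -- The left side equals `(√2 - 1)/2`, so the factor `3/4` leaves room for finite `N`.
    have hlt : (10 * √2 - 14) * (3 + 2 * √2) * 1⁻¹ / 4 < (√2 - 1) * (3 / 4) := by
      nlinarith [Real.sq_sqrt (show (0 : ℝ) ≤ 2 by norm_num)]
    filter_upwards [h3.eventually_lt_const hlt] with N hN
    simpa [inv_div] using hN.le
  have hr := tendsto_later_correction hP hh hh1 κ hm hn hn0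
  refine ⟨fun N => laterConst h (P N) (v N) (m N)
      * Real.exp (κ * (Real.log (P N) * (h - m N / n N))
        + Real.log (3 + 2 * √2) * ((m N / n N - h) * (P N / h - n N))),
    fun N => firstConst h (P N) T (v N) (m N), ?_, tendsto_firstConst hP hT hm hv, ?_, ?_⟩
  · simpa using (tendsto_laterConst hP hh hm hv).mul hr
  · have hpos : 0 < laterLimit h := by
      have hw : (3 + 2 * √2) ^ (-h) < 1 := Real.rpow_lt_one_of_one_lt_of_neg
        (by linarith [Real.sqrt_nonneg 2]) (neg_neg_of_pos hh)
      have hΓ : 0 < Real.Gamma (1 + h) := Real.Gamma_pos_of_pos (by linarith)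
      have hα := log_three_add_pos
      unfold laterLimit
      exact div_pos (by positivity) (mul_pos (by linarith) hΓ)
    filter_upwards [(tendsto_laterConst hP hh hm hv).eventually_const_lt hpos] with N hN
    exact mul_nonneg hN.le (Real.exp_pos _).le
  filter_upwards [hP.eventually_gt_atTop 0, hv0, hL, hbase] with N hPN hvN hLN hbN
  intro a b ha hb Q
  have hα := log_three_add_pos
  have hg := ten_mul_sqrt_two_sub_pos
  have hc := cH_pos hH hH'
  have hlevel : level H N 1 = m N := by
    simp only [level, hmdef, hPdef, hhdef, one_mul, add_comm (1 / 2 : ℝ) H]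
  have hnum : numIntervals H N 1 = n N := by
    simp only [numIntervals, hndef, hhdef, div_one, one_mul, add_comm (1 / 2 : ℝ) H]
  have haP : a = (10 * √2 - 14) / Real.exp 1 * P N * T⁻¹ := ha
  have ha0 : 0 < a := by rw [haP]; positivity
  have hb' : b = (10 * √2 - 14) / Real.exp 1 * P N ^ (1 - κ) * T⁻¹ := hb
  have hb0 : 0 < b := by rw [hb']; positivity
  have hcut : cutoff H N (Real.log (3 + 2 * √2)) b
      = b * Real.exp (Real.log (3 + 2 * √2) * (P N / h)) := by
    rw [cutoff, ← hPh, Real.sqrt_div (Nat.cast_nonneg N), add_comm (1 / 2 : ℝ) H, ← hhdef]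
    congr 2; ring
  -- This is where `stepExponent` comes from: `n` steps of ratio `exp v` lead from `a` to the
  -- cutoff, and `b/a = P^(-κ)` accounts for the logarithmic term.
  have hratio : cutoff H N (Real.log (3 + 2 * √2)) b / a = Real.exp (n N * v N) := by
    have hnN : (n N : ℝ) ≠ 0 := by have := hn0 N; positivity
    have h1 : b / a = P N ^ (-κ) := by
      rw [hb', haP, show 1 - κ = -κ + 1 by ring, Real.rpow_add_one hPN.ne']
      field_simp
    rw [hcut, mul_div_right_comm, h1, Real.rpow_def_of_pos hPN, ← Real.exp_add, hvdef]
    simp only [stepExponent]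
    congr 1
    field_simp
    ring
  have hxi : ∀ i, xi H N (Real.log (3 + 2 * √2)) 1 a b (i + 1)
      = a * Real.exp ((i + 1 : ℕ) * v N) := by
    intro i
    have hnN : (n N : ℝ) ≠ 0 := by have := hn0 N; positivity
    rw [xi, if_neg (Nat.succ_ne_zero i), hratio, hnum, ← Real.exp_mul]
    congr 2
    field_simp
  have hxi1 : xi H N (Real.log (3 + 2 * √2)) 1 a b 1 = a * Real.exp (v N) := by
    rw [hxi 0]; simp
  have hxin : xi H N (Real.log (3 + 2 * √2)) 1 a b (n N)
      = b * Real.exp (Real.log (3 + 2 * √2) * (P N / h)) := by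
    obtain ⟨k, hk⟩ := Nat.exists_eq_succ_of_ne_zero (hn0 N).ne'
    rw [hk, Nat.succ_eq_add_one, hxi k, ← Nat.succ_eq_add_one, ← hk, ← hratio, hcut,
      mul_div_cancel₀ _ ha0.ne']
  have hq : 1 < Real.exp (v N) := Real.one_lt_exp_iff.2 hvN
  have hηN : 0 < h / (2 * (m N : ℝ)) := by have := hm0 N; positivity
  have hz : Real.cosh (gaussRate (v N) - h / (2 * m N))
      < (Real.exp (v N) + 1) / (Real.exp (v N) - 1) := by
    rw [← cosh_gaussRate hvN, Real.cosh_lt_cosh, abs_of_pos hLN, abs_of_pos (by linarith)]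
    linarith
  have hmain := Q.l1Error_le hH hH' hhdef hT hq (by rw [hxi1]; positivity)
    (fun i => by
      rw [hxi (i + 1), hxi i, show (((i + 1 + 1 : ℕ) : ℝ) * v N)
        = v N + ((i + 1 : ℕ) : ℝ) * v N by push_cast; ring, Real.exp_add]
      ring) hLN hz
  rw [hlevel, hnum, hxi1, hxin] at hmain
  have hlater := later_bound hh hPN hT hvN (hm0 N) hLN
  have hfirst := first_bound (c := cH H) hh1 hPN hT (hm0 N)
    (by linarith [(abs_le.1 (hm N)).1]) hc.le hbN
  have htail : (b * Real.exp (Real.log (3 + 2 * √2) * (P N / h))) ^ (-h) / h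
      = T ^ h * Real.exp (-(Real.log (3 + 2 * √2) * P N))
        * ((Real.exp 1 / (10 * √2 - 14)) ^ h / h * P N ^ (-((1 - κ) * h))) := by
    have e1 : b = (Real.exp 1 / (10 * √2 - 14))⁻¹ * P N ^ (1 - κ) * T⁻¹ := by
      rw [hb', inv_div]
    have e2 : Real.exp (Real.log (3 + 2 * √2) * (P N / h)) ^ (-h)
        = Real.exp (-(Real.log (3 + 2 * √2) * P N)) := by
      rw [← Real.exp_mul]; congr 1; field_simp
    have e3 : 0 < Real.exp 1 / (10 * √2 - 14) := by positivity
    rw [Real.mul_rpow hb0.le (Real.exp_pos _).le, e2, e1,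
      Real.mul_rpow (by positivity) (by positivity), Real.mul_rpow (by positivity) (by positivity),
      Real.inv_rpow e3.le, Real.inv_rpow hT.le, Real.rpow_neg e3.le, Real.rpow_neg hT.le,
      inv_inv, inv_inv, ← Real.rpow_mul hPN.le, show (1 - κ) * -h = -((1 - κ) * h) by ring]
    ring
  rw [exp_later_eq hh hPN (hn0 N), ← haP] at hlater
  rw [← haP] at hfirst
  rw [htail] at hmain
  change _ ≤ cH H * T ^ h * Real.exp (-(Real.log (3 + 2 * √2) * P N))
    * ((Real.exp 1 / (10 * √2 - 14)) ^ h / h * P N ^ (-((1 - κ) * h))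
      + P N ^ (-(κ * h)) * Real.exp (Real.log (3 + 2 * √2)
        * ((P N - m N) + h * (√(N / h) - n N))) * _ + P N ^ (-h) * _)
  rw [hPh]
  have hl := mul_le_mul_of_nonneg_left hlater hc.le
  refine hmain.trans ?_
  rw [mul_add (cH H)]
  refine (add_le_add (add_le_add le_rfl hl) hfirst).trans (le_of_eq ?_)
  ring

end RoughKernel

/-! ### The two regimes: dominant tail, and tail balanced with the later intervals. -/

namespace RoughKernel

open Set

theorem sqrt_two_add_one_rpow (x : ℝ) :
    (√2 + 1) ^ x = Real.exp (Real.log (3 + 2 * √2) / 2 * x) := by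
  rw [add_comm, ← exp_half_log_three_add, ← Real.exp_mul]

theorem eventually_l1Error_le_tail {H T : ℝ} (hH : -(1 / 2) < H) (hH' : H < 1 / 2) (hT : 0 < T)
    {ε : ℝ} (hε : 0 < ε) :
    ∀ᶠ N : ℕ in atTop, ∀ Q : GeometricGaussianRule H N (Real.log (3 + 2 * √2)) 1
        ((10 * √2 - 14) / Real.exp 1 * √((H + 1 / 2) * N) * T⁻¹)
        ((10 * √2 - 14) / Real.exp 1 * T⁻¹),
      Q.l1Error T ≤ (1 + ε) *
        (cH H / (H + 1 / 2) * T ^ (H + 1 / 2) * (Real.exp 1 / (10 * √2 - 14)) ^ (H + 1 / 2)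
          * (√2 + 1) ^ (-2 * √((H + 1 / 2) * N))) := by
  obtain ⟨D, R, hD, hR, hD0, hmain⟩ := exists_eventually_l1Error_le (κ := 1) hH hH' hT
  have hh : 0 < H + 1 / 2 := by linarith
  have hh1 : H + 1 / 2 < 1 := by linarith
  generalize H + 1 / 2 = h at *
  have hP : Tendsto (fun N : ℕ => √(h * N)) atTop atTop :=
    Real.tendsto_sqrt_atTop.comp (tendsto_natCast_atTop_atTop.const_mul_atTop hh)
  have hPh : Tendsto (fun N : ℕ => √(h * N) ^ (-h)) atTop (𝓝 0) :=
    (tendsto_rpow_neg_atTop hh).comp hP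
  have hg := ten_mul_sqrt_two_sub_pos
  set C := (Real.exp 1 / (10 * √2 - 14)) ^ h / h with hC
  have hC0 : 0 < C := by positivity
  have hlim := ((hPh.mul ((hD.const_mul (Real.exp (2 * Real.log (3 + 2 * √2)))).add
    hR)).const_add C).eventually_lt_const
      (show C + 0 * (Real.exp (2 * Real.log (3 + 2 * √2)) * laterLimit h + 0) < (1 + ε) * C by
        nlinarith)
  have hc := cH_pos hH hH'
  filter_upwards [hmain, hlim, hD0, hP.eventually_gt_atTop 0] with N hN hlimN hDN hPN
  intro Q
  refine (hN _ _ rfl (by simp) Q).trans ?_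
  have hα := log_three_add_pos
  -- Here rounding costs at most a fixed factor, which disappears in the limit because the later
  -- intervals carry the vanishing factor `P^(-h)`.
  have hθ : Real.exp (Real.log (3 + 2 * √2) * ((√(h * N) - rd (√(h * N)))
      + h * (√(N / h) - rd (√(N / h))))) ≤ Real.exp (2 * Real.log (3 + 2 * √2)) := by
    rw [Real.exp_le_exp]
    have h1 := (abs_le.1 (abs_rd_sub_le (Real.sqrt_nonneg (h * N)))).1
    have h2 := (abs_le.1 (abs_rd_sub_le (Real.sqrt_nonneg (N / h)))).1
    have h3 : h * (√(N / h) - rd (√(N / h))) ≤ 1 := by nlinarith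
    have h4 := mul_le_mul_of_nonneg_left (show (√(h * N) - rd (√(h * N)))
      + h * (√(N / h) - rd (√(N / h))) ≤ 2 by linarith) hα.le
    linarith
  have hexp : (√2 + 1) ^ (-2 * √(h * N)) = Real.exp (-(Real.log (3 + 2 * √2) * √(h * N))) := by
    rw [sqrt_two_add_one_rpow]; congr 1; ring
  have e : √(h * N) ^ (-((1 - 1) * h)) = 1 := by simp
  rw [hexp, e, mul_one, one_mul]
  calc _ ≤ cH H * T ^ h * Real.exp (-(Real.log (3 + 2 * √2) * √(h * N))) * ((1 + ε) * C) := by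
        refine mul_le_mul_of_nonneg_left (le_trans ?_ hlimN.le) (by positivity)
        rw [add_assoc, mul_add (√(h * N) ^ (-h)), ← mul_assoc (√(h * N) ^ (-h))]
        gcongr
    _ = _ := by rw [hC]; ring

theorem eventually_l1Error_le_max {H T : ℝ} (hH : -(1 / 2) < H) (hH' : H < 1 / 2) (hT : 0 < T)
    {ε : ℝ} (hε : 0 < ε) :
    ∀ᶠ N : ℕ in atTop, ∀ Q : GeometricGaussianRule H N (Real.log (3 + 2 * √2)) 1
        ((10 * √2 - 14) / Real.exp 1 * √((H + 1 / 2) * N) * T⁻¹)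
        ((10 * √2 - 14) / Real.exp 1 * ((H + 1 / 2) * N) ^ (1 / 4 : ℝ) * T⁻¹),
      Q.l1Error T ≤ (1 + ε) *
        (max (200 / 3) (5 / (H + 1 / 2)) * roundingFactor H N * cH H * T ^ (H + 1 / 2)
          * (N : ℝ) ^ (-H / 4 - 1 / 8) * (√2 + 1) ^ (-2 * √((H + 1 / 2) * N))) := by
  obtain ⟨D, R, hD, hR, hD0, hmain⟩ := exists_eventually_l1Error_le (κ := 1 / 2) hH hH' hT
  have hh : 0 < H + 1 / 2 := by linarith
  have hh1 : H + 1 / 2 < 1 := by linarith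
  have hround : ∀ N : ℕ, roundingFactor H N = max 1 ((√2 + 1) ^ (2 * (√((H + 1 / 2) * N)
      - rd (√((H + 1 / 2) * N))) + 2 * (H + 1 / 2) * (√(N / (H + 1 / 2))
      - rd (√(N / (H + 1 / 2)))))) := fun _ => rfl
  have hNexp : -H / 4 - 1 / 8 = -(H + 1 / 2) / 4 := by ring
  simp only [hround, hNexp]
  generalize H + 1 / 2 = h at *
  have hP : Tendsto (fun N : ℕ => √(h * N)) atTop atTop :=
    Real.tendsto_sqrt_atTop.comp (tendsto_natCast_atTop_atTop.const_mul_atTop hh)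
  have hPh : Tendsto (fun N : ℕ => √(h * N) ^ (-(h / 2))) atTop (𝓝 0) :=
    (tendsto_rpow_neg_atTop (by positivity)).comp hP
  have hg := ten_mul_sqrt_two_sub_pos
  set C := (Real.exp 1 / (10 * √2 - 14)) ^ h / h with hC
  have hC0 : 0 < C := by positivity
  set M := max (200 / 3) (5 / h) with hM
  have hM0 : 0 < M := lt_max_of_lt_left (by norm_num)
  -- The first-interval term has no known sign here; its absolute value allows multiplication by the
  -- rounding factor, which is at least `1`. The strict inequality comes from `constant_le` and the
  -- slack `ε M`.
  have hlim := (((hD.const_add C).add (hPh.mul hR).abs).const_mul (h ^ (-h / 4))).eventually_lt_const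
      (show h ^ (-h / 4) * (C + laterLimit h + |0 * 0|) < (1 + ε) * M by
        have := constant_le hh hh1
        rw [mul_zero, abs_zero, add_zero]
        nlinarith)
  have hc := cH_pos hH hH'
  filter_upwards [hmain, hlim, hD0, hP.eventually_gt_atTop 0, eventually_gt_atTop 0]
    with N hN hlimN hDN hPN hN0
  intro Q
  have hN0' : (0 : ℝ) < N := by exact_mod_cast hN0
  have hsq : ∀ p : ℝ, √(h * N) ^ p = (h * N) ^ (p / 2) := by
    intro p
    rw [Real.sqrt_eq_rpow, ← Real.rpow_mul (by positivity)]
    congr 1; ring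
  refine (hN _ _ rfl (by rw [hsq]; norm_num) Q).trans ?_
  have hexp : (√2 + 1) ^ (-2 * √(h * N)) = Real.exp (-(Real.log (3 + 2 * √2) * √(h * N))) := by
    rw [sqrt_two_add_one_rpow]; congr 1; ring
  set θ := max 1 ((√2 + 1) ^ (2 * (√(h * N) - rd (√(h * N))) + 2 * h * (√(N / h)
      - rd (√(N / h))))) with hθ
  have hθ1 : 1 ≤ θ := le_max_left _ _
  have hθ2 : Real.exp (Real.log (3 + 2 * √2) * ((√(h * N) - rd (√(h * N)))
      + h * (√(N / h) - rd (√(N / h))))) ≤ θ := by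
    refine le_trans (le_of_eq ?_) (le_max_right _ _)
    rw [sqrt_two_add_one_rpow]; congr 1; ring
  have e1 : √(h * N) ^ (-((1 - 1 / 2) * h)) = √(h * N) ^ (-(h / 2)) := by congr 1; ring
  have e2 : √(h * N) ^ (-(1 / 2 * h)) = √(h * N) ^ (-(h / 2)) := by congr 1; ring
  have e3 : √(h * N) ^ (-h) = √(h * N) ^ (-(h / 2)) * √(h * N) ^ (-(h / 2)) := by
    rw [← Real.rpow_add hPN]; congr 1; ring
  have e4 : √(h * N) ^ (-(h / 2)) = h ^ (-h / 4) * (N : ℝ) ^ (-h / 4) := by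
    rw [hsq, ← Real.mul_rpow hh.le hN0'.le]; congr 1; ring
  rw [hexp, e1, e2, e3]
  set ρ := √(h * N) ^ (-(h / 2)) with hρ
  have hρ0 : 0 < ρ := by positivity
  generalize Real.exp (Real.log (3 + 2 * √2) * ((√(h * N) - rd (√(h * N)))
      + h * (√(N / h) - rd (√(N / h))))) = θ' at *
  have hbr : C * ρ + ρ * θ' * D N + ρ * ρ * R N
      ≤ θ * (N : ℝ) ^ (-h / 4) * ((1 + ε) * M) := by
    have h1 : ρ * R N ≤ θ * |ρ * R N| :=
      (le_abs_self _).trans (le_mul_of_one_le_left (abs_nonneg _) hθ1)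
    have h2 : θ' * D N ≤ θ * D N := mul_le_mul_of_nonneg_right hθ2 hDN
    have h3 : C ≤ θ * C := le_mul_of_one_le_left hC0.le hθ1
    calc C * ρ + ρ * θ' * D N + ρ * ρ * R N = ρ * (C + θ' * D N + ρ * R N) := by ring
      _ ≤ ρ * (θ * C + θ * D N + θ * |ρ * R N|) := by gcongr
      _ = θ * (N : ℝ) ^ (-h / 4) * (h ^ (-h / 4) * (C + D N + |ρ * R N|)) := by
          linear_combination (θ * (C + D N + |ρ * R N|)) * e4
      _ ≤ _ := by
          refine mul_le_mul_of_nonneg_left hlimN.le ?_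
          have : 0 ≤ θ := by linarith
          positivity
  calc _ ≤ cH H * T ^ h * Real.exp (-(Real.log (3 + 2 * √2) * √(h * N)))
        * (θ * (N : ℝ) ^ (-h / 4) * ((1 + ε) * M)) :=
        mul_le_mul_of_nonneg_left hbr (by positivity)
    _ = _ := by ring

end RoughKernel

theorem mainTheorem7 (H T : ℝ) (hH : -(1 / 2) < H) (hH' : H < 1 / 2) (hT : 0 < T) :
    (∀ ε : ℝ, 0 < ε → ∀ᶠ N : ℕ in atTop,
      ∀ Q : RoughKernel.GeometricGaussianRule H N (Real.log (3 + 2 * √2)) 1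
        ((10 * √2 - 14) / Real.exp 1 * √((H + 1 / 2) * N) * T⁻¹)
        ((10 * √2 - 14) / Real.exp 1 * T⁻¹),
      Q.l1Error T ≤ (1 + ε) *
        (RoughKernel.cH H / (H + 1 / 2) * T ^ (H + 1 / 2)
          * (Real.exp 1 / (10 * √2 - 14)) ^ (H + 1 / 2)
          * (√2 + 1) ^ (-2 * √((H + 1 / 2) * N)))) ∧
    (∀ ε : ℝ, 0 < ε → ∀ᶠ N : ℕ in atTop,
      ∀ Q : RoughKernel.GeometricGaussianRule H N (Real.log (3 + 2 * √2)) 1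
        ((10 * √2 - 14) / Real.exp 1 * √((H + 1 / 2) * N) * T⁻¹)
        ((10 * √2 - 14) / Real.exp 1 * ((H + 1 / 2) * N) ^ (1 / 4 : ℝ) * T⁻¹),
      Q.l1Error T ≤ (1 + ε) *
        (max (200 / 3) (5 / (H + 1 / 2)) * RoughKernel.roundingFactor H N
          * RoughKernel.cH H * T ^ (H + 1 / 2) * (N : ℝ) ^ (-H / 4 - 1 / 8)
          * (√2 + 1) ^ (-2 * √((H + 1 / 2) * N)))) :=
  ⟨fun _ hε => RoughKernel.eventually_l1Error_le_tail hH hH' hT hε,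
    fun _ hε => RoughKernel.eventually_l1Error_le_max hH hH' hT hε⟩
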